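/- All rings are commutative and noetherian. For such a ring $R$ let $D^b(R)$ be the bounded derived category of finitely generated $R$-modules; a finite ring endomorphism $\phi$ of $R$ induces, by restriction of scalars along $\phi$, an exact endofunctor $\phi_*$ of $D^b(R)$. For full subcategories $\mathcal X,\mathcal Y$ of a triangulated category $\mathcal T$ let $\mathcal X*\mathcal Y$ consist of all $Z$ in an exact triangle $X\to Z\to Y\to X[1]$ with $X\in\mathcal X$, $Y\in\mathcal Y$. For objects $X,Y$ and $t\in\mathbb R$ put $$\delta_t(X,Y)=\inf\Big\{\sum_{i=1}^r e^{n_it}\ \Big|\ r\ge 1,\ n_1,\dots,n_r\in\mathbb Z,\ Y\oplus Y'\in X[n_1]*\cdots*X[n_r]\text{ for some }Y'\in\mathcal T\Big\}\in[0,\infty].$$ An object $G$ is a split generator if the smallest thick subcategory containing $G$ is $\mathcal T$. For an exact endofunctor $\Phi$ of a triangulated category with a split generator $G$, the categorical entropy is $h_t(\Phi)=\lim_{e\to\infty}\frac1e\log\delta_t(G,\Phi^e(G))\in[-\infty,\infty)$, read as $-\infty$ if $\delta_t(G,\Phi^e(G))=0$ for some (equivalently, all large) $e$; it does not depend on $G$.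 For sequences, $a_e=\Omega(b_e)$ means that there is a real $c>0$ with $a_e\ge c\,b_e$ for all large $e$. **Corollary 3.3.** Let $t$ be a real number. (1) Let $(R,\mathfrak m,k)$ be a $d$-dimensional local ring of prime characteristic $p$ whose Frobenius endomorphism $F$ is finite, and let $[F_*k:k]$ be the degree of $k$ over itself via its Frobenius. Then for every split generator $G$ of $D^b(R)$ one has $$\delta_t(G,F_*^eG)=\Omega\big(([F_*k:k]\,p^d)^e\big),$$ the limit defining $h_t(F_*)$ exists and does not depend on $G$, and $h_t(F_*)\ge d\log p+\log[F_*k:k]$. (2) Let $k$ be a field, let $\Gamma$ be a finitely generated commutative (additive) monoid without nonzero invertible elements, and let $R=k[\![\Gamma]\!]$ be the completion of the monoid ring $k[\Gamma]=\bigoplus_{a\in\Gamma}k\,t^a$ with respect to its maximal ideal $(t^a\mid a\ne0)$; put $d=\dim R$. Let $m\ge1$ be an integer and $F_m:R\to R$ the (finite) ring endomorphism induced by the $k$-algebra endomorphism $t^a\mapsto t^{ma}$ of $k[\Gamma]$. Then for every split generator $G$ of $D^b(R)$ one has $$\delta_t(G,(F_m)_*^eG)=\Omega(m^{de}),$$ the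 limit defining $h_t((F_m)_*)$ exists and does not depend on $G$, and $h_t((F_m)_*)\ge d\log m$. -/

import Mathlib

open CategoryTheory CategoryTheory.Limits CategoryTheory.Pretriangulated
open scoped ENNReal Topology

universe u v w u' w'

noncomputable section

namespace CategoricalEntropy

section Complexity

variable {C : Type*} [Category* C] [HasZeroObject C] [HasShift C ℤ] [Preadditive C]
  [∀ n : ℤ, (shiftFunctor C n).Additive] [Pretriangulated C]

/-- `G` is a split generator: the smallest thick subcategory containing `G` is everything. -/
def IsSplitGenerator (G : C) : Prop :=
  (ObjectProperty.singleton G).IsClassicalTriangulatedGenerator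

/-- `X[n] * X[j₁] * ⋯ * X[jᵣ]` (associated to the left) for `l = [j₁, …, jᵣ]`, where
`𝒳 * 𝒴` consists of the `Z` in an exact triangle `X → Z → Y → X[1]` with `X ∈ 𝒳`, `Y ∈ 𝒴`. -/
def shiftStar (X : C) (n : ℤ) (l : List ℤ) : ObjectProperty C :=
  l.foldl (fun P j => P.extensionProduct (ObjectProperty.singleton (X⟦j⟧)).isoClosure)
    (ObjectProperty.singleton (X⟦n⟧)).isoClosure

/-- The complexity `δ_t(X, Y) ∈ [0, ∞]` of `Y` with respect to `X`. -/
def complexity (t : ℝ) (X Y : C) : ℝ≥0∞ :=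
  sInf {s | ∃ (n : ℤ) (l : List ℤ) (Y' : C), shiftStar X n l (Y ⊞ Y') ∧
    s = ENNReal.ofReal (((n :: l).map fun j : ℤ => Real.exp (j * t)).sum)}

/-- The limit of `log δ_t(G, Φ^e G) / e` if `δ_t(G, Φ^e G) ≠ 0` for all large `e`, and `-∞`
otherwise. -/
def entropyAlong (t : ℝ) (Φ : C ⥤ C) (G : C) : EReal :=
  open Classical in
  if ∀ᶠ e : ℕ in Filter.atTop, complexity t G (Φ.obj^[e] G) ≠ 0 then
    Filter.limUnder Filter.atTop fun e : ℕ =>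
      ENNReal.log (complexity t G (Φ.obj^[e] G)) / (e : EReal)
  else ⊥

/-- The categorical entropy `h_t(Φ)`, computed with some split generator. It is meaningful only if
a split generator exists. -/
def categoricalEntropy (t : ℝ) (Φ : C ⥤ C) : EReal :=
  open Classical in
  if h : ∃ G : C, IsSplitGenerator G then entropyAlong t Φ h.choose else ⊥

end Complexity

/-- `a_n = Ω(b_n)`: there is a real `c > 0` with `a_n ≥ c b_n` for all large `n`. -/
def IsBigOmega (a : ℕ → ℝ≥0∞) (b : ℕ → ℝ) : Prop :=
  ∃ c : ℝ, 0 < c ∧ ∀ᶠ n in Filter.atTop, ENNReal.ofReal (c * b n) ≤ a n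

section Pushforward

variable {R : Type u} {S : Type u} [CommRing R] [CommRing S]

/-- The pushforward (restriction of scalars) `φ_* : mod S ⥤ mod R` along a finite ring
homomorphism `φ : R →+* S`. -/
def fgPushforward (φ : R →+* S) (hφ : φ.Finite) : FGModuleCat.{u} S ⥤ FGModuleCat.{u} R :=
  (ModuleCat.isFG.{u} R).lift ((ModuleCat.isFG.{u} S).ι ⋙ ModuleCat.restrictScalars.{u} φ)
    (fun M => by
      let _ : Algebra R S := φ.toAlgebra
      let _ : Module R M.obj := Module.compHom M.obj φ
      have : Module.Finite R S := hφ
      have : Module.Finite S M.obj := M.property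
      have : IsScalarTower R S M.obj := ⟨fun r s m => mul_smul (φ r) s m⟩
      have h : Module.Finite R M.obj := Module.Finite.trans S M.obj
      exact h)

instance (φ : R →+* S) (hφ : φ.Finite) : (fgPushforward φ hφ).Additive where
  map_add := rfl

variable [IsNoetherianRing R] [IsNoetherianRing S]

instance (φ : R →+* S) (hφ : φ.Finite) : PreservesFiniteLimits (fgPushforward φ hφ) := by
  have : PreservesFiniteLimits (fgPushforward φ hφ ⋙ forget₂ (FGModuleCat R) (ModuleCat.{u} R)) :=
    inferInstanceAs (PreservesFiniteLimits
      (forget₂ (FGModuleCat S) (ModuleCat.{u} S) ⋙ ModuleCat.restrictScalars.{u} φ))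
  exact ⟨fun _ _ _ => preservesLimitsOfShape_of_reflects_of_preserves _
    (forget₂ (FGModuleCat R) (ModuleCat.{u} R))⟩

instance (φ : R →+* S) (hφ : φ.Finite) : PreservesFiniteColimits (fgPushforward φ hφ) := by
  have : PreservesFiniteColimits (fgPushforward φ hφ ⋙ forget₂ (FGModuleCat R) (ModuleCat.{u} R)) :=
    inferInstanceAs (PreservesFiniteColimits
      (forget₂ (FGModuleCat S) (ModuleCat.{u} S) ⋙ ModuleCat.restrictScalars.{u} φ))
  exact ⟨fun _ _ _ => preservesColimitsOfShape_of_reflects_of_preserves _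
    (forget₂ (FGModuleCat R) (ModuleCat.{u} R))⟩

variable (R) in
/-- `D^b(mod R)`: the bounded derived category of the abelian category of finitely generated
modules over the noetherian ring `R`. -/
abbrev Db [HasDerivedCategory.{w} (FGModuleCat.{u} R)] :=
  DerivedCategory.Bounded (FGModuleCat.{u} R)

variable [HasDerivedCategory.{w} (FGModuleCat.{u} R)] [HasDerivedCategory.{w} (FGModuleCat.{u} S)]

lemma bounded_map (φ : R →+* S) (hφ : φ.Finite) (X : Db S) :
    (DerivedCategory.TStructure.t (C := FGModuleCat.{u} R)).bounded
      ((fgPushforward φ hφ).mapDerivedCategory.obj X.obj) := by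
  obtain ⟨X, ⟨a, ha⟩, ⟨b, hb⟩⟩ := X
  obtain ⟨K, _, _, ⟨e⟩⟩ := X.exists_iso_Q_obj_of_isGE_of_isLE a b
  refine ObjectProperty.prop_of_iso _ ((fgPushforward φ hφ).mapDerivedCategory.mapIso e ≪≫
    (fgPushforward φ hφ).mapDerivedCategoryFactors.app K).symm ?_
  refine ⟨⟨a, ⟨⟨_, Iso.refl _, ?_⟩⟩⟩, ⟨b, ⟨⟨_, Iso.refl _, ?_⟩⟩⟩⟩
  · infer_instance
  · infer_instance

/-- The functor `φ_* : D^b(mod S) ⥤ D^b(mod R)` induced by the exact functor `φ_*` on modules. -/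
def pushforward (φ : R →+* S) (hφ : φ.Finite) : Db S ⥤ Db R :=
  ObjectProperty.lift _ (DerivedCategory.Bounded.ι ⋙ (fgPushforward φ hφ).mapDerivedCategory)
    (bounded_map φ hφ)

instance (φ : R →+* S) (hφ : φ.Finite) : (pushforward φ hφ).CommShift ℤ :=
  inferInstanceAs ((ObjectProperty.lift _ _ _).CommShift ℤ)

instance (φ : R →+* S) (hφ : φ.Finite) : (pushforward φ hφ).IsTriangulated :=
  inferInstanceAs ((ObjectProperty.lift _ _ _).IsTriangulated)

end Pushforward

section ResidueDegree

/-- The Frobenius endomorphism of a ring of prime characteristic reflects units. -/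
instance isLocalHom_frobenius {R : Type*} [CommRing R] (p : ℕ) [Fact p.Prime] [CharP R p] :
    IsLocalHom (frobenius R p) where
  map_nonunit a ha := by
    rw [frobenius_def] at ha
    exact (isUnit_pow_iff (Fact.out : p.Prime).ne_zero).1 ha

/-- `[φ_* k : k]` for a local endomorphism `φ` of a local ring with residue field `k`: the
dimension of `k` as a vector space over itself via the endomorphism of `k` induced by `φ`. -/
def residueDegree {R : Type u} [CommRing R] [IsLocalRing R] (φ : R →+* R) [IsLocalHom φ] : ℕ :=
  Module.finrank (IsLocalRing.ResidueField R)
    ((ModuleCat.restrictScalars (IsLocalRing.ResidueField.map φ)).obj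
      (ModuleCat.of (IsLocalRing.ResidueField R) (IsLocalRing.ResidueField R)))

end ResidueDegree

section Completion

variable {A : Type u} {B : Type v} [CommRing A] [CommRing B]

theorem completionMap_compat (I : Ideal A) (J : Ideal B) (f : A →+* B) (h : I ≤ J.comap f)
    {m n : ℕ} (hmn : m ≤ n) :
    (Ideal.Quotient.factorPow J hmn).comp ((Ideal.quotientMap (J ^ n) f
      ((Ideal.pow_right_mono h n).trans (Ideal.le_comap_pow f n))).comp
        (AdicCompletion.evalₐ I n : AdicCompletion I A →+* A ⧸ I ^ n)) =
    (Ideal.quotientMap (J ^ m) f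
      ((Ideal.pow_right_mono h m).trans (Ideal.le_comap_pow f m))).comp
        (AdicCompletion.evalₐ I m : AdicCompletion I A →+* A ⧸ I ^ m) := by
  ext x
  obtain ⟨a, rfl⟩ := AdicCompletion.mk_surjective I A x
  simp only [RingHom.comp_apply, RingHom.coe_coe, AdicCompletion.evalₐ_mk,
    Ideal.quotientMap_mk]
  change Ideal.Quotient.mk _ _ = _
  rw [Ideal.Quotient.eq, ← map_sub]
  refine ((Ideal.pow_right_mono h m).trans (Ideal.le_comap_pow f m)) ?_
  rw [← Ideal.Quotient.eq]
  exact AdicCompletion.Ideal.mk_eq_mk I hmn a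

/-- The ring homomorphism between adic completions induced by a ring homomorphism `f` with
`f(I) ⊆ J`. -/
def completionMap (I : Ideal A) (J : Ideal B) (f : A →+* B) (h : I ≤ J.comap f) :
    AdicCompletion I A →+* AdicCompletion J B :=
  AdicCompletion.liftRingHom J
    (fun n => (Ideal.quotientMap (J ^ n) f
      ((Ideal.pow_right_mono h n).trans (Ideal.le_comap_pow f n))).comp
        (AdicCompletion.evalₐ I n : AdicCompletion I A →+* A ⧸ I ^ n))
    (completionMap_compat I J f h)

theorem completionMap_of (I : Ideal A) (J : Ideal B) (f : A →+* B) (h : I ≤ J.comap f) (a : A) :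
    completionMap I J f h (algebraMap A _ a) = algebraMap B _ (f a) := by
  apply AdicCompletion.ext_evalₐ
  intro n
  refine (AdicCompletion.evalₐ_liftRingHom J _ (completionMap_compat I J f h) n _).trans ?_
  simp

theorem finite_of_generators (I : Ideal A) (hI : I.FG) (φ : AdicCompletion I A →+* B)
    (hB : IsHausdorff (I.map (φ.comp (algebraMap A _))) B) {n : ℕ} (s : Fin n → B)
    (hs : ∀ x : B, ∃ c : Fin n → A,
      x - ∑ j, φ (algebraMap A _ (c j)) * s j ∈ I.map (φ.comp (algebraMap A _))) :
    φ.Finite := by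
  let _ : Algebra (AdicCompletion I A) B := φ.toAlgebra
  let _ : Algebra A B := (φ.comp (algebraMap A _)).toAlgebra
  have : IsScalarTower A (AdicCompletion I A) B := .of_algebraMap_eq fun _ => rfl
  have hH : IsHausdorff I B := IsHausdorff.map_algebraMap_iff.mp hB
  have hP : IsAdicComplete I (AdicCompletion I (Fin n → A)) := AdicCompletion.isAdicComplete hI
  let F : (Fin n → AdicCompletion I A) →ₗ[AdicCompletion I A] B :=
    Fintype.linearCombination (AdicCompletion I A) s
  let G : AdicCompletion I (Fin n → A) →ₗ[A] B :=
    (F ∘ₗ (AdicCompletion.piEquivFin I n).toLinearMap).restrictScalars A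
  have hG : Function.Surjective G := by
    apply surjective_of_mkQ_comp_surjective (I := I)
    intro y
    obtain ⟨x, rfl⟩ := Submodule.mkQ_surjective _ y
    obtain ⟨c, hc⟩ := hs x
    refine ⟨(AdicCompletion.piEquivFin I n).symm fun j => algebraMap A _ (c j), ?_⟩
    have hval : G ((AdicCompletion.piEquivFin I n).symm fun j => algebraMap A _ (c j)) =
        ∑ j, φ (algebraMap A _ (c j)) * s j := by
      simp only [G, F, LinearMap.restrictScalars_apply, LinearMap.comp_apply,
        LinearEquiv.coe_coe, LinearEquiv.apply_symm_apply, Fintype.linearCombination_apply]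
      rfl
    rw [LinearMap.comp_apply, hval, eq_comm, Submodule.mkQ_apply, Submodule.mkQ_apply,
      Submodule.Quotient.eq, Ideal.smul_top_eq_map]
    exact hc
  have hF : Function.Surjective F := fun y => by
    obtain ⟨x, hx⟩ := hG y
    exact ⟨_, hx⟩
  exact Module.Finite.of_surjective F hF

theorem completionMap_finite (I : Ideal A) (J : Ideal B) (hI : I.FG) (hJ : J.FG) (f : A →+* B)
    (h : I ≤ J.comap f) (hf : f.Finite) {M : ℕ} (hM : J ^ M ≤ I.map f) :
    (completionMap I J f h).Finite := by
  have hcomp : (completionMap I J f h).comp (algebraMap A _) =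
      (algebraMap B (AdicCompletion J B)).comp f := RingHom.ext (completionMap_of I J f h)
  let _ : Algebra A B := f.toAlgebra
  have : Module.Finite A B := hf
  obtain ⟨n, s, hs⟩ := Module.Finite.exists_fin (R := A) (M := B)
  have hc := AdicCompletion.isAdicComplete_self J hJ
  refine finite_of_generators I hI _ ?_ (fun j => algebraMap B _ (s j)) fun x => ?_
  · refine ⟨fun x hx => hc.haus' x fun n => (hx n).mono ?_⟩
    rw [hcomp, ← Ideal.map_map]
    exact Submodule.smul_mono_left (Ideal.pow_right_mono (Ideal.map_mono (Ideal.map_le_iff_le_comap.2 h)) n)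
  · rw [hcomp, ← Ideal.map_map]
    obtain ⟨b, hb⟩ := Ideal.Quotient.mk_surjective (AdicCompletion.evalₐ J M x)
    have hb' : b ∈ Submodule.span A (Set.range s) := hs ▸ Submodule.mem_top
    obtain ⟨c, hc⟩ := (Submodule.mem_span_range_iff_exists_fun A).1 hb'
    refine ⟨c, Ideal.map_mono hM ?_⟩
    have hsum : ∑ j, completionMap I J f h (algebraMap A _ (c j)) *
        algebraMap B (AdicCompletion J B) (s j) = algebraMap B _ b := by
      simp only [completionMap_of, ← map_mul, ← map_sum]
      exact congrArg _ hc
    rw [hsum, ← Submodule.restrictScalars_mem B, ← Ideal.smul_top_eq_map,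
      AdicCompletion.pow_smul_top_eq_ker_eval hJ, LinearMap.mem_ker, map_sub, sub_eq_zero]
    have hle : J ^ M ≤ J ^ M • (⊤ : Ideal B) := by simp
    rw [← AdicCompletion.factor_evalₐ_eq_eval J x hle,
      ← AdicCompletion.factor_evalₐ_eq_eval J _ hle, ← hb]
    simp

end Completion

section Monoid

variable (k : Type u) [Field k] (Γ : Type v) [AddCommMonoid Γ]

/-- The ideal `(t^a : a ≠ 0)` of the monoid algebra `k[Γ]`; it is generated by the `t^(a_i)` for
any system of nonzero generators `a_i` of `Γ`. -/
def monomialIdeal : Ideal (AddMonoidAlgebra k Γ) :=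
  Ideal.span ((fun a => AddMonoidAlgebra.single a 1) '' {a : Γ | a ≠ 0})

/-- `k[[Γ]]`: the completion of `k[Γ]` with respect to the ideal `(t^a : a ≠ 0)`. -/
abbrev MonoidPowerSeries : Type (max u v) :=
  AdicCompletion (monomialIdeal k Γ) (AddMonoidAlgebra k Γ)

variable {Γ} in
theorem single_mem_monomialIdeal {a : Γ} (ha : a ≠ 0) (c : k) :
    AddMonoidAlgebra.single a c ∈ monomialIdeal k Γ := by
  have := Ideal.mul_mem_left (monomialIdeal k Γ) (AddMonoidAlgebra.single 0 c)
    (Ideal.subset_span ⟨a, ha, rfl⟩)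
  simpa [AddMonoidAlgebra.single_mul_single] using this

/-- The endomorphism `t^a ↦ t^(m a)` of the `k`-algebra `k[Γ]`. -/
def monoidMulHom (m : ℕ) : AddMonoidAlgebra k Γ →+* AddMonoidAlgebra k Γ :=
  AddMonoidAlgebra.mapDomainRingHom k (nsmulAddMonoidHom (α := Γ) m)

variable {Γ} in
theorem monoidMulHom_single (m : ℕ) (a : Γ) (c : k) :
    monoidMulHom k Γ m (AddMonoidAlgebra.single a c) = AddMonoidAlgebra.single (m • a) c := by
  simp [monoidMulHom]

theorem monomialIdeal_le_comap [Subsingleton (AddUnits Γ)] {m : ℕ} (hm : 0 < m) :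
    monomialIdeal k Γ ≤ (monomialIdeal k Γ).comap (monoidMulHom k Γ m) := by
  refine Ideal.span_le.2 ?_
  rintro _ ⟨a, ha, rfl⟩
  change monoidMulHom k Γ m _ ∈ monomialIdeal k Γ
  rw [monoidMulHom_single]
  refine single_mem_monomialIdeal k (fun h0 => ha ?_) 1
  obtain ⟨n, rfl⟩ := Nat.exists_eq_add_of_lt hm
  rw [zero_add, succ_nsmul] at h0
  exact (add_eq_zero.1 h0).2

/-- The endomorphism `F_m` of `k[[Γ]]` induced by `t^a ↦ t^(m a)`, for a commutative monoid `Γ`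
without nonzero invertible elements and `m ≥ 1`. -/
def mulEndo [Subsingleton (AddUnits Γ)] (m : ℕ) (hm : 0 < m) :
    MonoidPowerSeries k Γ →+* MonoidPowerSeries k Γ :=
  completionMap _ _ (monoidMulHom k Γ m) (monomialIdeal_le_comap k Γ hm)

variable [AddMonoid.FG Γ]

instance : IsNoetherianRing (AddMonoidAlgebra k Γ) := Algebra.FiniteType.isNoetherianRing k _

instance : IsNoetherianRing (MonoidPowerSeries k Γ) := by
  obtain ⟨S, hS⟩ := AddMonoid.fg_def.1 (inferInstance : AddMonoid.FG Γ)
  let T : Set Γ := {a | a ∈ S ∧ a ≠ 0}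
  have hT : T.Finite := S.finite_toSet.subset fun a ha => ha.1
  have : Finite T := hT
  have hcl : AddSubmonoid.closure T = ⊤ := by
    rw [eq_top_iff, ← hS]
    refine AddSubmonoid.closure_le.2 fun a ha => ?_
    by_cases h0 : a = 0
    · rw [h0]; exact AddSubmonoid.zero_mem _
    · exact AddSubmonoid.subset_closure ⟨ha, h0⟩
  let π : MvPolynomial T k →ₐ[k] AddMonoidAlgebra k Γ :=
    MvPolynomial.aeval fun s : T => AddMonoidAlgebra.of' k Γ s
  have hπ : Function.Surjective π :=
    AddMonoidAlgebra.mvPolynomial_aeval_of_surjective_of_closure hcl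
  have hX : ∀ s : T, π (MvPolynomial.X s) = AddMonoidAlgebra.single (s : Γ) 1 := fun s => by
    simp [π, AddMonoidAlgebra.of']
  have hmap : monomialIdeal k Γ ≤ (MvPolynomial.idealOfVars T k).map (π : _ →+* _) := by
    refine Ideal.span_le.2 ?_
    rintro _ ⟨a, ha, rfl⟩
    have key : ∀ b : Γ, b = 0 ∨ AddMonoidAlgebra.single b (1 : k) ∈
        (MvPolynomial.idealOfVars T k).map (π : _ →+* AddMonoidAlgebra k Γ) := by
      intro b
      have hb : b ∈ AddSubmonoid.closure T := hcl ▸ AddSubmonoid.mem_top b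
      induction hb using AddSubmonoid.closure_induction with
      | mem s hs =>
        right
        rw [← hX ⟨s, hs⟩]
        exact Ideal.mem_map_of_mem _ (Ideal.subset_span ⟨_, rfl⟩)
      | zero => exact Or.inl rfl
      | add x y _ _ hx hy =>
        rcases hx with rfl | hx
        · simpa using hy
        · right
          have := Ideal.mul_mem_right (AddMonoidAlgebra.single y (1 : k)) _ hx
          simpa [AddMonoidAlgebra.single_mul_single] using this
    exact (key a).resolve_left ha
  have hle : MvPolynomial.idealOfVars T k ≤ (monomialIdeal k Γ).comap (π : _ →+* _) := by
    refine Ideal.span_le.2 ?_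
    rintro _ ⟨s, rfl⟩
    change π _ ∈ monomialIdeal k Γ
    rw [hX]
    exact single_mem_monomialIdeal k s.2.2 1
  have hfin := completionMap_finite (MvPolynomial.idealOfVars T k) (monomialIdeal k Γ)
    (MvPolynomial.idealOfVars_fg T k) (IsNoetherian.noetherian _) (π : _ →+* _) hle
    (RingHom.Finite.of_surjective _ hπ) (M := 1) (by rwa [pow_one])
  have hN : IsNoetherianRing (AdicCompletion (MvPolynomial.idealOfVars T k) (MvPolynomial T k)) :=
    isNoetherianRing_of_ringEquiv _ (MvPowerSeries.toAdicCompletionAlgEquiv T k).toRingEquiv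
  let _ := (completionMap _ _ _ hle).toAlgebra
  have : Module.Finite (AdicCompletion (MvPolynomial.idealOfVars T k) (MvPolynomial T k))
    (MonoidPowerSeries k Γ) := hfin
  exact isNoetherian_of_tower (AdicCompletion (MvPolynomial.idealOfVars T k) (MvPolynomial T k))
    (isNoetherian_of_isNoetherianRing_of_finite _ _)

theorem monoidMulHom_finite {m : ℕ} (hm : 0 < m) : (monoidMulHom k Γ m).Finite := by
  refine RingHom.IsIntegral.to_finite ?_ ?_
  · intro x
    induction x using AddMonoidAlgebra.induction_linear with
    | zero => exact RingHom.isIntegralElem_zero _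
    | add x y hx hy => exact hx.add _ hy
    | single a c =>
      let _ := (monoidMulHom k Γ m).toAlgebra
      refine IsIntegral.of_pow (R := AddMonoidAlgebra k Γ) hm ?_
      rw [AddMonoidAlgebra.single_pow, ← monoidMulHom_single]
      exact RingHom.isIntegralElem_map _
  · have hcomp : (monoidMulHom k Γ m).comp (algebraMap k _) = algebraMap k _ := by
      ext c
      simp [monoidMulHom_single]
    refine RingHom.FiniteType.of_comp_finiteType (f := algebraMap k (AddMonoidAlgebra k Γ)) ?_
    rw [hcomp]
    exact RingHom.finiteType_algebraMap.2 inferInstance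

theorem mulEndo_finite [Subsingleton (AddUnits Γ)] (m : ℕ) (hm : 0 < m) :
    (mulEndo k Γ m hm).Finite := by
  obtain ⟨M, hM⟩ := Ideal.exists_pow_le_of_le_radical_of_fg
    (I := monomialIdeal k Γ) (J := (monomialIdeal k Γ).map (monoidMulHom k Γ m))
    (by
      refine Ideal.span_le.2 ?_
      rintro _ ⟨a, ha, rfl⟩
      refine ⟨m, ?_⟩
      rw [AddMonoidAlgebra.single_pow, one_pow, ← monoidMulHom_single]
      exact Ideal.mem_map_of_mem _ (single_mem_monomialIdeal k ha 1))
    (IsNoetherian.noetherian _)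
  exact completionMap_finite _ _ (IsNoetherian.noetherian _) (IsNoetherian.noetherian _) _ _
    (monoidMulHom_finite k Γ hm) hM

end Monoid
end CategoricalEntropy

end

open CategoricalEntropy

/-!
The entropy of `φ_*`, for a finite local endomorphism `φ` of a noetherian local ring `(R, 𝔪, k)`
with `φ(𝔪) R ⊆ 𝔪 ^ q`, is bounded below by a numerical invariant of objects of `D^b(R)`. For a fixed
object `A`, the weighted length `L(Z) = ∑ⱼ exp (-j t) ℓ (Hom (A, Z[j]))` is subadditive on exact
triangles and is multiplied by `exp (n t)` under the shift by `n`, so that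
`L(Y) ≤ δ_t(G, Y) L(G)` whenever `L` is finite (`le_complexity_mul`). Since
`δ_t(G, Φ^e Y) ≤ δ_t(G, Φ^e G) δ_t(G, Y)`, a lower bound on the growth of `L(Φ^e Y)` for a single
object `Y` gives one for `δ_t(G, Φ^e G)` and every split generator `G`
(`isBigOmega_of_weightedLength`).

For `A` take the Koszul object on generators `x₁, …, xᵣ` of `𝔪`, built from `R[0]` by iterated cones
(`exists_koszulObject`). Powers of the `xᵢ` act as zero on `A` and `Hom (R[0], Z[j])` is finitely
generated and vanishes for large `|j|`, so `L` is finite. For a module `M` the top nonzero group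
`Hom (A, M[r])` surjects onto `M / 𝔪 M`, hence onto every quotient of `M` killed by `𝔪`. For
`M = φ^e_* R` such a quotient is `φ^e_* (R / 𝔪 ^ (q ^ e))`, whose length is
`[φ_* k : k] ^ e ℓ (R / 𝔪 ^ (q ^ e))` (`length_restrictIter`). As `ℓ (R / 𝔪 ^ n)` grows at least like
`n ^ dim R` (`exists_pow_le_length_quotient`), the complexity grows at least like
`([φ_* k : k] q ^ dim R) ^ e` (`isBigOmega_complexity_pushforward`). Submultiplicativity of `δ_t` and
Fekete's lemma turn such a bound into the existence of the entropy, its independence of the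
generator, and the lower bound for it (`tendsto_categoricalEntropy`).

The Frobenius endomorphism has `q = p`. For `k[[Γ]]`, which is local with maximal ideal generated by
the `t^a` with `a ≠ 0`, the endomorphism `t^a ↦ t^(m a) = (t^a)^m` has `q = m`, and the residue
degree is at least `1`.
-/

noncomputable section

namespace CategoricalEntropy

/-! ### Building objects by extensions, and the complexity -/

section Complexity

variable {C : Type*} [Category* C] [HasZeroObject C] [HasShift C ℤ] [Preadditive C]
  [∀ n : ℤ, (shiftFunctor C n).Additive] [Pretriangulated C]

/-- In a pretriangulated category the retracts of an object are its direct summands. -/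
lemma retractClosure_iff_biprod (P : ObjectProperty C) [P.IsClosedUnderIsomorphisms] (Z : C) :
    P.retractClosure Z ↔ ∃ Z' : C, P (Z ⊞ Z') := by
  constructor
  · rintro ⟨W, hW, ⟨r⟩⟩
    obtain ⟨Z', g, h, hT⟩ := distinguished_cocone_triangle r.i
    have : IsSplitMono r.i := ⟨⟨⟨r.r, r.retract⟩⟩⟩
    have h0 : h = 0 := Triangle.mor₃_eq_zero_of_mono₁ _ hT (inferInstanceAs (Mono r.i))
    obtain ⟨e, -⟩ := exists_iso_binaryBiproduct_of_distTriang _ hT h0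
    exact ⟨Z', P.prop_of_iso e hW⟩
  · rintro ⟨Z', h⟩
    exact ⟨_, h, ⟨⟨biprod.inl, biprod.fst, by simp⟩⟩⟩

@[simp]
lemma shiftStar_nil (X : C) (n : ℤ) :
    shiftStar X n [] = (ObjectProperty.singleton (X⟦n⟧)).isoClosure := rfl

lemma shiftStar_concat (X : C) (n : ℤ) (l : List ℤ) (j : ℤ) :
    shiftStar X n (l ++ [j]) = (shiftStar X n l).extensionProduct
      (ObjectProperty.singleton (X⟦j⟧)).isoClosure := by
  simp [shiftStar]

instance (X : C) (n : ℤ) (l : List ℤ) : (shiftStar X n l).IsClosedUnderIsomorphisms := by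
  induction l using List.reverseRecOn with
  | nil => rw [shiftStar_nil]; infer_instance
  | append_singleton l j _ => rw [shiftStar_concat]; infer_instance

omit [HasZeroObject C] [HasShift C ℤ] [Preadditive C]
  [∀ n : ℤ, (shiftFunctor C n).Additive] [Pretriangulated C] in
lemma isoClosure_singleton_iff (X Y : C) :
    (ObjectProperty.singleton X).isoClosure Y ↔ Nonempty (Y ≅ X) := by
  constructor
  · rintro ⟨Y', h, ⟨e⟩⟩
    obtain rfl : X = Y' := by simpa using h
    exact ⟨e⟩
  · rintro ⟨e⟩
    exact ⟨X, by simp, ⟨e⟩⟩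

lemma shiftStar_append [IsTriangulated C] (X : C) (n : ℤ) (l : List ℤ) (m : ℤ) (l' : List ℤ) :
    shiftStar X n (l ++ m :: l') = (shiftStar X n l).extensionProduct (shiftStar X m l') := by
  induction l' using List.reverseRecOn with
  | nil => rw [shiftStar_concat, shiftStar_nil]
  | append_singleton l' j ih =>
    rw [← List.cons_append, ← List.append_assoc, shiftStar_concat, ih, shiftStar_concat,
      ObjectProperty.extensionProduct_assoc]

lemma shiftStar_shift (X : C) (n : ℤ) (l : List ℤ) (m : ℤ) (Z : C) (h : shiftStar X n l Z) :
    shiftStar X (n + m) (l.map (· + m)) (Z⟦m⟧) := by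
  induction l using List.reverseRecOn generalizing Z with
  | nil =>
    rw [shiftStar_nil, isoClosure_singleton_iff] at h
    obtain ⟨e⟩ := h
    rw [List.map_nil, shiftStar_nil, isoClosure_singleton_iff]
    exact ⟨(shiftFunctor C m).mapIso e ≪≫ ((shiftFunctorAdd C n m).app X).symm⟩
  | append_singleton l j ih =>
    rw [shiftStar_concat] at h
    obtain ⟨A, B, f, g, k, hT, hA, hB⟩ := h
    rw [isoClosure_singleton_iff] at hB
    obtain ⟨e⟩ := hB
    rw [List.map_append, List.map_singleton, shiftStar_concat]
    refine ⟨_, _, _, _, _, Triangle.shift_distinguished _ hT m, ih A hA, ?_⟩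
    rw [isoClosure_singleton_iff]
    exact ⟨(shiftFunctor C m).mapIso e ≪≫ ((shiftFunctorAdd C j m).app X).symm⟩

section Functor

variable {D : Type*} [Category* D] [HasZeroObject D] [HasShift D ℤ] [Preadditive D]
  [∀ n : ℤ, (shiftFunctor D n).Additive] [Pretriangulated D]

lemma shiftStar_map (F : C ⥤ D) [F.CommShift ℤ] [F.IsTriangulated] (X : C) (n : ℤ) (l : List ℤ)
    (Z : C) (h : shiftStar X n l Z) : shiftStar (F.obj X) n l (F.obj Z) := by
  induction l using List.reverseRecOn generalizing Z with
  | nil =>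
    rw [shiftStar_nil, isoClosure_singleton_iff] at h ⊢
    exact h.map fun e => F.mapIso e ≪≫ (F.commShiftIso n).app X
  | append_singleton l j ih =>
    rw [shiftStar_concat] at h ⊢
    obtain ⟨A, B, f, g, k, hT, hA, hB⟩ := h
    refine ⟨_, _, _, _, _, F.map_distinguished _ hT, ih A hA, ?_⟩
    rw [isoClosure_singleton_iff] at hB ⊢
    exact hB.map fun e => F.mapIso e ≪≫ (F.commShiftIso j).app X

end Functor

/-- The objects that are direct summands of an object of `X[n] * X[j₁] * ⋯ * X[jᵣ]`, where
`l = [j₁, …, jᵣ]`. -/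
def summandStar (X : C) (n : ℤ) (l : List ℤ) : ObjectProperty C :=
  (shiftStar X n l).retractClosure

/-- The weight `∑ exp (j t)` of a list of shifts. -/
def shiftCost (t : ℝ) (l : List ℤ) : ℝ := (l.map fun j : ℤ => Real.exp (j * t)).sum

lemma shiftCost_nonneg (t : ℝ) (l : List ℤ) : 0 ≤ shiftCost t l :=
  List.sum_nonneg fun x hx => by
    obtain ⟨j, -, rfl⟩ := List.mem_map.1 hx
    positivity

lemma shiftCost_append (t : ℝ) (l l' : List ℤ) :
    shiftCost t (l ++ l') = shiftCost t l + shiftCost t l' := by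
  simp [shiftCost]

lemma shiftCost_map_add (t : ℝ) (l : List ℤ) (m : ℤ) :
    shiftCost t (l.map (· + m)) = shiftCost t l * Real.exp (m * t) := by
  induction l with
  | nil => simp [shiftCost]
  | cons a l ih =>
    simp only [shiftCost, List.map_cons, List.sum_cons] at ih ⊢
    rw [ih, add_mul, ← Real.exp_add]
    push_cast
    ring_nf

lemma complexity_eq (t : ℝ) (X Y : C) : complexity t X Y =
    sInf {s | ∃ (n : ℤ) (l : List ℤ), summandStar X n l Y ∧
      s = ENNReal.ofReal (shiftCost t (n :: l))} := by
  unfold complexity summandStar shiftCost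
  congr 1
  ext s
  simp only [Set.mem_ofPred_eq, retractClosure_iff_biprod]
  constructor
  · rintro ⟨n, l, Y', h, e⟩
    exact ⟨n, l, ⟨Y', h⟩, e⟩
  · rintro ⟨n, l, ⟨Y', h⟩, e⟩
    exact ⟨n, l, Y', h, e⟩

lemma complexity_le {t : ℝ} {X Y : C} {n : ℤ} {l : List ℤ} (h : summandStar X n l Y) :
    complexity t X Y ≤ ENNReal.ofReal (shiftCost t (n :: l)) := by
  rw [complexity_eq]
  exact sInf_le ⟨n, l, h, rfl⟩

lemma complexity_lt_iff {t : ℝ} {X Y : C} {b : ℝ≥0∞} : complexity t X Y < b ↔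
    ∃ (n : ℤ) (l : List ℤ), summandStar X n l Y ∧ ENNReal.ofReal (shiftCost t (n :: l)) < b := by
  rw [complexity_eq, sInf_lt_iff]
  constructor
  · rintro ⟨_, ⟨n, l, h, rfl⟩, hb⟩
    exact ⟨n, l, h, hb⟩
  · rintro ⟨n, l, h, hb⟩
    exact ⟨_, ⟨n, l, h, rfl⟩, hb⟩

lemma summandStar_self (X : C) : summandStar X 0 [] X :=
  ObjectProperty.le_retractClosure _ _ <| by
    rw [shiftStar_nil, isoClosure_singleton_iff]
    exact ⟨((shiftFunctorZero C ℤ).app X).symm⟩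

/-- Composition of two ways of building objects: the shifts get added and the weights
multiplied. -/
lemma summandStar_comp [IsTriangulated C] (t : ℝ) {X Y Z : C} {n m : ℤ} {l l' : List ℤ}
    (hY : summandStar X n l Y) (hZ : summandStar Y m l' Z) :
    ∃ (a : ℤ) (b : List ℤ), summandStar X a b Z ∧
      shiftCost t (a :: b) = shiftCost t (n :: l) * shiftCost t (m :: l') := by
  have hshift : ∀ j : ℤ, (ObjectProperty.singleton (Y⟦j⟧)).isoClosure ≤
      summandStar X (n + j) (l.map (· + j)) := by
    intro j W hW
    obtain ⟨e⟩ := (isoClosure_singleton_iff _ _).1 hW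
    obtain ⟨Y', hY', ⟨r⟩⟩ := hY
    exact ⟨_, shiftStar_shift X n l j Y' hY',
      ⟨(Retract.ofIso e).trans (r.map (shiftFunctor C j))⟩⟩
  have hcost : ∀ j : ℤ, shiftCost t ((n + j) :: l.map (· + j)) =
      shiftCost t (n :: l) * Real.exp (j * t) := fun j => shiftCost_map_add t (n :: l) j
  suffices H : ∃ (a : ℤ) (b : List ℤ), shiftStar Y m l' ≤ summandStar X a b ∧
      shiftCost t (a :: b) = shiftCost t (n :: l) * shiftCost t (m :: l') by
    obtain ⟨a, b, h, hc⟩ := H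
    refine ⟨a, b, ?_, hc⟩
    obtain ⟨W, hW, ⟨r⟩⟩ := hZ
    obtain ⟨V, hV, ⟨s⟩⟩ := h W hW
    exact ⟨V, hV, ⟨r.trans s⟩⟩
  clear hZ
  induction l' using List.reverseRecOn with
  | nil =>
    refine ⟨n + m, l.map (· + m), ?_, ?_⟩
    · rw [shiftStar_nil]
      exact hshift m
    · rw [hcost]
      simp [shiftCost]
  | append_singleton l' j ih =>
    obtain ⟨a, b, h, hc⟩ := ih
    refine ⟨a, b ++ (n + j) :: l.map (· + j), ?_, ?_⟩
    · rw [shiftStar_concat, summandStar, shiftStar_append]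
      refine le_trans ?_ (ObjectProperty.extensionProduct_retractClosure_retractClosure_le _ _)
      exact (ObjectProperty.monotone_extensionProduct_left _ h).trans
        (ObjectProperty.monotone_extensionProduct_right _ (hshift j))
    · rw [← List.cons_append, shiftCost_append, hc, hcost, ← List.cons_append, shiftCost_append]
      simp only [shiftCost, List.map_cons, List.sum_cons, List.map_nil, List.sum_nil]
      ring

/-- Submultiplicativity of the complexity. -/
lemma complexity_mul_le [IsTriangulated C] {t : ℝ} {X Y Z : C} (hXY : complexity t X Y ≠ ∞)
    (hYZ : complexity t Y Z ≠ ∞) : complexity t X Z ≤ complexity t X Y * complexity t Y Z := by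
  refine ENNReal.le_mul_of_forall_lt (.inr hYZ) (.inl hXY) fun a ha b hb => ?_
  obtain ⟨n, l, h, h'⟩ := complexity_lt_iff.1 ha
  obtain ⟨m, l', k, k'⟩ := complexity_lt_iff.1 hb
  obtain ⟨i, j, hij, e⟩ := summandStar_comp t h k
  refine (complexity_le hij).trans ?_
  rw [e, ENNReal.ofReal_mul (shiftCost_nonneg _ _)]
  gcongr

lemma complexity_map_le {D : Type*} [Category* D] [HasZeroObject D] [HasShift D ℤ] [Preadditive D]
    [∀ n : ℤ, (shiftFunctor D n).Additive] [Pretriangulated D]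
    (F : C ⥤ D) [F.CommShift ℤ] [F.IsTriangulated] (t : ℝ) (X Y : C) :
    complexity t (F.obj X) (F.obj Y) ≤ complexity t X Y := by
  refine le_of_forall_gt fun b hb => ?_
  obtain ⟨n, l, ⟨W, hW, ⟨r⟩⟩, h'⟩ := complexity_lt_iff.1 hb
  exact complexity_lt_iff.2 ⟨n, l, ⟨_, shiftStar_map F X n l W hW, ⟨r.map F⟩⟩, h'⟩

lemma complexity_map_iterate_le (F : C ⥤ C) [F.CommShift ℤ] [F.IsTriangulated] (t : ℝ) (X Y : C)
    (e : ℕ) : complexity t (F.obj^[e] X) (F.obj^[e] Y) ≤ complexity t X Y := by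
  induction e with
  | zero => exact le_rfl
  | succ e ih =>
    rw [Function.iterate_succ_apply', Function.iterate_succ_apply']
    exact (complexity_map_le F t _ _).trans ih

/-- The objects built from `X` form a thick subcategory. -/
lemma exists_summandStar [IsTriangulated C] {X : C} (hX : IsSplitGenerator X) (Y : C) :
    ∃ (n : ℤ) (l : List ℤ), summandStar X n l Y := by
  let P : ObjectProperty C := fun Y => ∃ (n : ℤ) (l : List ℤ), summandStar X n l Y
  have hP : ∀ Y, P Y ↔ ∃ (n : ℤ) (l : List ℤ), summandStar X n l Y := fun _ => Iff.rfl
  have h1 : P.IsStableUnderRetracts := ⟨by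
    rintro Y Z r ⟨n, l, W, hW, ⟨s⟩⟩
    exact ⟨n, l, W, hW, ⟨r.trans s⟩⟩⟩
  have h0 : P.Nonempty := ⟨X, 0, [], summandStar_self X⟩
  have h2 : P.IsStableUnderShift ℤ := ⟨fun a => ⟨by
    rintro Y ⟨n, l, W, hW, ⟨s⟩⟩
    exact ⟨_, _, _, shiftStar_shift X n l a W hW, ⟨s.map (shiftFunctor C a)⟩⟩⟩⟩
  have h3 : P.IsTriangulatedClosed₂ := .mk' <| by
    rintro T hT ⟨n, l, h⟩ ⟨m, l', h'⟩
    refine ⟨n, l ++ m :: l', ?_⟩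
    rw [summandStar, shiftStar_append]
    exact ObjectProperty.extensionProduct_retractClosure_retractClosure_le _ _ _
      ⟨_, _, _, _, _, hT, h, h'⟩
  have h4 : P.IsTriangulated := { }
  have key : (ObjectProperty.singleton X).triangEnvelope ≤ P := by
    rw [ObjectProperty.triangEnvelope_le_iff]
    intro Y hY
    obtain rfl : X = Y := by simpa using hY
    exact ⟨0, [], summandStar_self X⟩
  exact key Y (by rw [show _ = _ from hX]; trivial)

lemma complexity_ne_top [IsTriangulated C] {X : C} (hX : IsSplitGenerator X) (t : ℝ) (Y : C) :
    complexity t X Y ≠ ∞ := by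
  obtain ⟨n, l, h⟩ := exists_summandStar hX Y
  exact ne_top_of_le_ne_top ENNReal.ofReal_ne_top (complexity_le h)

/-- A subadditive numerical invariant that scales by `exp (n t)` under the shift by `n` bounds the
complexity from below. -/
lemma le_complexity_mul {t : ℝ} (L : C → ℝ≥0∞)
    (hL : ∀ T ∈ distTriang C, L T.obj₂ ≤ L T.obj₁ + L T.obj₃)
    (hr : ∀ {X Y : C}, Retract X Y → L X ≤ L Y)
    (hs : ∀ (X : C) (n : ℤ), L (X⟦n⟧) ≤ ENNReal.ofReal (Real.exp (n * t)) * L X)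
    (X Y : C) (hX : L X ≠ ∞) (hXY : complexity t X Y ≠ ∞) : L Y ≤ complexity t X Y * L X := by
  have hsingle : ∀ (j : ℤ) (W : C), (ObjectProperty.singleton (X⟦j⟧)).isoClosure W →
      L W ≤ ENNReal.ofReal (Real.exp (j * t)) * L X := by
    intro j W hW
    obtain ⟨e⟩ := (isoClosure_singleton_iff _ _).1 hW
    exact (hr (.ofIso e)).trans (hs X j)
  have key : ∀ (n : ℤ) (l : List ℤ) (W : C), shiftStar X n l W →
      L W ≤ ENNReal.ofReal (shiftCost t (n :: l)) * L X := by
    intro n l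
    induction l using List.reverseRecOn with
    | nil =>
      intro W hW
      simpa [shiftCost] using hsingle n W hW
    | append_singleton l j ih =>
      intro W hW
      rw [shiftStar_concat] at hW
      obtain ⟨A, B, f, g, k, hT, hA, hB⟩ := hW
      refine (hL _ hT).trans ((add_le_add (ih A hA) (hsingle j B hB)).trans ?_)
      rw [← List.cons_append, shiftCost_append, ENNReal.ofReal_add (shiftCost_nonneg _ _)
        (shiftCost_nonneg _ _), add_mul]
      simp [shiftCost]
  have key' : ∀ (n : ℤ) (l : List ℤ), summandStar X n l Y →
      L Y ≤ ENNReal.ofReal (shiftCost t (n :: l)) * L X := by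
    rintro n l ⟨W, hW, ⟨r⟩⟩
    exact (hr r).trans (key n l W hW)
  refine ENNReal.le_mul_of_forall_lt (.inr hX) (.inl hXY) fun a ha b hb => ?_
  obtain ⟨n, l, h, h'⟩ := complexity_lt_iff.1 ha
  exact (key' n l h).trans (by gcongr)

end Complexity

/-! ### Existence of the entropy, and its independence of the generator -/

section Entropy

variable {C : Type*} [Category* C] [HasZeroObject C] [HasShift C ℤ] [Preadditive C]
  [∀ n : ℤ, (shiftFunctor C n).Additive] [Pretriangulated C] [IsTriangulated C]
  (Φ : C ⥤ C) [Φ.CommShift ℤ] [Φ.IsTriangulated] {t : ℝ}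

lemma complexity_iterate_add_le {G : C} (hG : IsSplitGenerator G) (m n : ℕ) :
    complexity t G (Φ.obj^[m + n] G) ≤
      complexity t G (Φ.obj^[m] G) * complexity t G (Φ.obj^[n] G) := by
  rw [Function.iterate_add_apply]
  have h := complexity_map_iterate_le Φ t G (Φ.obj^[n] G) m
  have hn := complexity_ne_top hG t (Φ.obj^[n] G)
  exact (complexity_mul_le (complexity_ne_top hG t _) (ne_top_of_le_ne_top hn h)).trans
    (by gcongr)

lemma complexity_iterate_le {G G' : C} (hG : IsSplitGenerator G) (hG' : IsSplitGenerator G')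
    (e : ℕ) : complexity t G' (Φ.obj^[e] G') ≤
      complexity t G' G * complexity t G (Φ.obj^[e] G) * complexity t G G' := by
  have h1 := complexity_map_iterate_le Φ t G G' e
  have h2 := complexity_ne_top hG t G'
  have h3 : complexity t G (Φ.obj^[e] G') ≤
      complexity t G (Φ.obj^[e] G) * complexity t G G' :=
    (complexity_mul_le (complexity_ne_top hG t _) (ne_top_of_le_ne_top h2 h1)).trans (by gcongr)
  refine (complexity_mul_le (complexity_ne_top hG' t G) (complexity_ne_top hG t _)).trans ?_
  rw [mul_assoc]
  gcongr

variable {Φ} in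
lemma complexity_iterate_ne_zero {G : C} (hG : IsSplitGenerator G) {b : ℝ} (hb : 0 < b)
    (h : IsBigOmega (fun e => complexity t G (Φ.obj^[e] G)) (fun e => b ^ e)) (e : ℕ) :
    complexity t G (Φ.obj^[e] G) ≠ 0 := by
  intro h0
  obtain ⟨c, hc, hev⟩ := h
  obtain ⟨n, hn⟩ := (hev.and (Filter.eventually_ge_atTop e)).exists
  obtain ⟨k, rfl⟩ := Nat.exists_eq_add_of_le hn.2
  have h1 := hn.1.trans (complexity_iterate_add_le Φ hG e k)
  rw [h0, zero_mul] at h1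
  have h2 : 0 < ENNReal.ofReal (c * b ^ (e + k)) := ENNReal.ofReal_pos.2 (by positivity)
  exact absurd h1 (not_le.2 h2)

variable (t) in
/-- The sequence `log δ_t(G, Φ^e G)`, as real numbers. -/
def logComplexity (G : C) (e : ℕ) : ℝ := Real.log (complexity t G (Φ.obj^[e] G)).toReal

variable {Φ}

lemma log_complexity_div {G : C} (hG : IsSplitGenerator G) {b : ℝ} (hb : 0 < b)
    (h : IsBigOmega (fun e => complexity t G (Φ.obj^[e] G)) (fun e => b ^ e)) (e : ℕ) :
    ENNReal.log (complexity t G (Φ.obj^[e] G)) / (e : EReal) =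
      ((logComplexity Φ t G e / e : ℝ) : EReal) := by
  rw [ENNReal.log_pos_real (complexity_iterate_ne_zero hG hb h e) (complexity_ne_top hG t _),
    EReal.coe_div]
  rfl

lemma toReal_complexity_pos {G : C} (hG : IsSplitGenerator G) {b : ℝ} (hb : 0 < b)
    (h : IsBigOmega (fun e => complexity t G (Φ.obj^[e] G)) (fun e => b ^ e)) (e : ℕ) :
    0 < (complexity t G (Φ.obj^[e] G)).toReal :=
  ENNReal.toReal_pos (complexity_iterate_ne_zero hG hb h e) (complexity_ne_top hG t _)

lemma subadditive_logComplexity {G : C} (hG : IsSplitGenerator G) {b : ℝ} (hb : 0 < b)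
    (h : IsBigOmega (fun e => complexity t G (Φ.obj^[e] G)) (fun e => b ^ e)) :
    Subadditive (logComplexity Φ t G) := by
  intro m n
  have hp := toReal_complexity_pos hG hb h
  unfold logComplexity
  rw [← Real.log_mul (hp m).ne' (hp n).ne', ← ENNReal.toReal_mul]
  refine Real.log_le_log (hp _) (ENNReal.toReal_mono ?_ (complexity_iterate_add_le Φ hG m n))
  exact ENNReal.mul_ne_top (complexity_ne_top hG t _) (complexity_ne_top hG t _)

/-- By Fekete's lemma `log δ_t(G, Φ^e G) / e` converges, with limit at least the exponential
growth rate of any lower bound. -/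
lemma exists_tendsto_logComplexity {G : C} (hG : IsSplitGenerator G) {b : ℝ} (hb : 0 < b)
    (h : IsBigOmega (fun e => complexity t G (Φ.obj^[e] G)) (fun e => b ^ e)) :
    ∃ x : ℝ, Filter.Tendsto (fun e : ℕ => logComplexity Φ t G e / e) Filter.atTop (𝓝 x) ∧
      Real.log b ≤ x := by
  obtain ⟨c, hc, hev⟩ := id h
  have hlow : ∀ᶠ e : ℕ in Filter.atTop, Real.log c / e + Real.log b ≤
      logComplexity Φ t G e / e := by
    filter_upwards [hev, Filter.eventually_gt_atTop 0] with e he he0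
    have he0' : (0 : ℝ) < e := by exact_mod_cast he0
    have h1 : Real.log (c * b ^ e) ≤ logComplexity Φ t G e := by
      refine Real.log_le_log (by positivity) ?_
      exact (ENNReal.ofReal_le_iff_le_toReal (complexity_ne_top hG t _)).1 he
    rw [Real.log_mul hc.ne' (by positivity), Real.log_pow] at h1
    rw [div_add' _ _ _ he0'.ne', div_le_div_iff_of_pos_right he0']
    linarith
  have hlim : Filter.Tendsto (fun e : ℕ => Real.log c / e + Real.log b) Filter.atTop
      (𝓝 (0 + Real.log b)) :=
    (tendsto_const_nhds.div_atTop tendsto_natCast_atTop_atTop).add tendsto_const_nhds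
  have hbdd : BddBelow (Set.range fun e : ℕ => logComplexity Φ t G e / e) := by
    refine Filter.IsBoundedUnder.bddBelow_range ⟨Real.log b - 1, ?_⟩
    rw [Filter.eventually_map]
    filter_upwards [hlow, hlim.eventually (lt_mem_nhds (show Real.log b - 1 < 0 + Real.log b by
      linarith))] with e h1 h2
    exact h2.le.trans h1
  have hT := (subadditive_logComplexity hG hb h).tendsto_lim hbdd
  refine ⟨_, hT, ?_⟩
  rw [zero_add] at hlim
  exact le_of_tendsto_of_tendsto hlim hT hlow

lemma tendsto_logComplexity_le {G G' : C} (hG : IsSplitGenerator G) (hG' : IsSplitGenerator G')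
    {b : ℝ} (hb : 0 < b)
    (h : IsBigOmega (fun e => complexity t G (Φ.obj^[e] G)) (fun e => b ^ e))
    (h' : IsBigOmega (fun e => complexity t G' (Φ.obj^[e] G')) (fun e => b ^ e)) {x x' : ℝ}
    (hx : Filter.Tendsto (fun e : ℕ => logComplexity Φ t G e / e) Filter.atTop (𝓝 x))
    (hx' : Filter.Tendsto (fun e : ℕ => logComplexity Φ t G' e / e) Filter.atTop (𝓝 x')) :
    x' ≤ x := by
  have hp := toReal_complexity_pos hG hb h
  have hp' := toReal_complexity_pos hG' hb h'
  have htop := complexity_ne_top hG t G'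
  have htop' := complexity_ne_top hG' t G
  set α := (complexity t G' G).toReal with hα
  set β := (complexity t G G').toReal with hβ
  have key : ∀ e, (complexity t G' (Φ.obj^[e] G')).toReal ≤
      α * (complexity t G (Φ.obj^[e] G)).toReal * β := by
    intro e
    rw [hα, hβ, ← ENNReal.toReal_mul, ← ENNReal.toReal_mul]
    exact ENNReal.toReal_mono (ENNReal.mul_ne_top (ENNReal.mul_ne_top htop'
      (complexity_ne_top hG t _)) htop) (complexity_iterate_le Φ hG hG' e)
  have hα0 : 0 < α := by
    refine lt_of_le_of_ne ENNReal.toReal_nonneg fun h0 => ?_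
    have := (hp' 0).trans_le (key 0)
    simp [← h0] at this
  have hβ0 : 0 < β := by
    refine lt_of_le_of_ne ENNReal.toReal_nonneg fun h0 => ?_
    have := (hp' 0).trans_le (key 0)
    simp [← h0] at this
  have hle : ∀ e : ℕ, logComplexity Φ t G' e / e ≤
      (Real.log α + Real.log β) / e + logComplexity Φ t G e / e := by
    intro e
    rw [← add_div]
    refine div_le_div_of_nonneg_right ?_ (Nat.cast_nonneg e)
    refine (Real.log_le_log (hp' e) (key e)).trans_eq ?_
    rw [Real.log_mul (mul_pos hα0 (hp e)).ne' hβ0.ne', Real.log_mul hα0.ne' (hp e).ne',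
      logComplexity]
    ring
  have hlim : Filter.Tendsto (fun e : ℕ => (Real.log α + Real.log β) / e +
      logComplexity Φ t G e / e) Filter.atTop (𝓝 (0 + x)) :=
    (tendsto_const_nhds.div_atTop tendsto_natCast_atTop_atTop).add hx
  rw [zero_add] at hlim
  exact le_of_tendsto_of_tendsto' hx' hlim hle

/-- If the complexities `δ_t(G, Φ^e G)` grow at least like `b ^ e` for every split generator `G`,
then the limit defining the entropy exists, is the same for all `G`, and is at least `log b`. -/
theorem tendsto_categoricalEntropy {b : ℝ} (hb : 0 < b)
    (h : ∀ G : C, IsSplitGenerator G →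
      IsBigOmega (fun e => complexity t G (Φ.obj^[e] G)) (fun e => b ^ e))
    {G : C} (hG : IsSplitGenerator G) :
    Filter.Tendsto (fun e : ℕ => ENNReal.log (complexity t G (Φ.obj^[e] G)) / (e : EReal))
      Filter.atTop (𝓝 (categoricalEntropy t Φ)) ∧
    ((Real.log b : ℝ) : EReal) ≤ categoricalEntropy t Φ := by
  have hex : ∃ G : C, IsSplitGenerator G := ⟨G, hG⟩
  have hG₀ := hex.choose_spec
  set G₀ := hex.choose with hG₀def
  obtain ⟨x, hx, hbx⟩ := exists_tendsto_logComplexity hG hb (h G hG)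
  obtain ⟨x₀, hx₀, -⟩ := exists_tendsto_logComplexity hG₀ hb (h G₀ hG₀)
  obtain rfl : x = x₀ := le_antisymm
    (tendsto_logComplexity_le hG₀ hG hb (h _ hG₀) (h _ hG) hx₀ hx)
    (tendsto_logComplexity_le hG hG₀ hb (h _ hG) (h _ hG₀) hx hx₀)
  have hE : ∀ {G' : C}, IsSplitGenerator G' →
      Filter.Tendsto (fun e : ℕ => logComplexity Φ t G' e / e) Filter.atTop (𝓝 x) →
      Filter.Tendsto (fun e : ℕ => ENNReal.log (complexity t G' (Φ.obj^[e] G')) / (e : EReal))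
        Filter.atTop (𝓝 (x : EReal)) := by
    intro G' hG' hT
    simp_rw [log_complexity_div hG' hb (h G' hG')]
    exact (continuous_coe_real_ereal.tendsto x).comp hT
  have hent : categoricalEntropy t Φ = x := by
    rw [categoricalEntropy, dif_pos hex, entropyAlong,
      if_pos (.of_forall fun e => complexity_iterate_ne_zero hG₀ hb (h _ hG₀) e)]
    exact (hE hG₀ hx₀).limUnder_eq
  rw [hent]
  exact ⟨hE hG hx, EReal.coe_le_coe_iff.2 hbx⟩

end Entropy

/-! ### Lengths of modules of morphisms -/

lemma length_le_add_of_exact {R M N P : Type*} [Ring R] [AddCommGroup M] [Module R M]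
    [AddCommGroup N] [Module R N] [AddCommGroup P] [Module R P] (f : M →ₗ[R] N) (g : N →ₗ[R] P)
    (h : ∀ x, g x = 0 → x ∈ LinearMap.range f) :
    Module.length R N ≤ Module.length R M + Module.length R P := by
  have hN := Module.length_eq_add_of_exact (LinearMap.ker g).subtype (LinearMap.ker g).mkQ
    (Submodule.subtype_injective _) (Submodule.mkQ_surjective _)
    (LinearMap.exact_subtype_mkQ _)
  rw [hN]
  refine add_le_add ?_ ?_
  · have hle : LinearMap.ker g ≤ LinearMap.range f := fun x hx => h x hx
    refine (Module.length_le_of_injective (Submodule.inclusion hle)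
      (Submodule.inclusion_injective _)).trans ?_
    exact Module.length_le_of_surjective f.rangeRestrict f.surjective_rangeRestrict
  · rw [(LinearMap.quotKerEquivRange g).length_eq]
    exact Module.length_le_of_injective (LinearMap.range g).subtype (Submodule.subtype_injective _)

section Linear

variable (R : Type*) [CommRing R] {C : Type*} [Category* C] [HasZeroObject C] [HasShift C ℤ]
  [Preadditive C] [∀ n : ℤ, (shiftFunctor C n).Additive] [Pretriangulated C] [Linear R C]

/-- The invariant `∑ⱼ exp (-j t) ℓ (Hom (A, Z[j]))` of an object `Z`, for a fixed object `A` of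
a linear triangulated category. -/
def weightedLength (t : ℝ) (A Z : C) : ℝ≥0∞ :=
  ∑' j : ℤ, ENNReal.ofReal (Real.exp (-j * t)) * (Module.length R (A ⟶ Z⟦j⟧) : ℝ≥0∞)

lemma weightedLength_triangle (t : ℝ) (A : C) (T : Triangle C) (hT : T ∈ distTriang C) :
    weightedLength R t A T.obj₂ ≤ weightedLength R t A T.obj₁ + weightedLength R t A T.obj₃ := by
  unfold weightedLength
  rw [← ENNReal.tsum_add]
  refine ENNReal.tsum_le_tsum fun j => ?_
  rw [← mul_add, ← ENat.toENNReal_add]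
  gcongr
  have hTj := Triangle.shift_distinguished _ hT j
  refine length_le_add_of_exact (Linear.rightComp R A ((Triangle.shiftFunctor C j).obj T).mor₁)
    (Linear.rightComp R A ((Triangle.shiftFunctor C j).obj T).mor₂) fun f hf => ?_
  obtain ⟨k, hk⟩ := Triangle.coyoneda_exact₂ _ hTj f hf
  exact ⟨k, hk.symm⟩

omit [HasZeroObject C] [∀ n : ℤ, (shiftFunctor C n).Additive] [Pretriangulated C] in
lemma weightedLength_retract (t : ℝ) (A : C) {X Y : C} (r : Retract X Y) :
    weightedLength R t A X ≤ weightedLength R t A Y := by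
  refine ENNReal.tsum_le_tsum fun j => ?_
  gcongr
  refine Module.length_le_of_injective (Linear.rightComp R A (r.i⟦j⟧')) fun f g h => ?_
  have h' : (f ≫ r.i⟦j⟧') ≫ r.r⟦j⟧' = (g ≫ r.i⟦j⟧') ≫ r.r⟦j⟧' := congrArg (· ≫ r.r⟦j⟧') h
  simpa [← Functor.map_comp] using h'

/-- Postcomposition with an isomorphism, as a linear equivalence. -/
def homPostcompEquiv (A : C) {X Y : C} (e : X ≅ Y) : (A ⟶ X) ≃ₗ[R] (A ⟶ Y) :=
  Linear.homCongr R (Iso.refl A) e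

omit [HasZeroObject C] [∀ n : ℤ, (shiftFunctor C n).Additive] [Pretriangulated C] in
lemma weightedLength_shift (t : ℝ) (A X : C) (n : ℤ) :
    weightedLength R t A (X⟦n⟧) ≤
      ENNReal.ofReal (Real.exp (n * t)) * weightedLength R t A X := by
  unfold weightedLength
  rw [← ENNReal.tsum_mul_left, ← (Equiv.addLeft n).tsum_eq
    fun j => ENNReal.ofReal (Real.exp (n * t)) * _]
  refine ENNReal.tsum_le_tsum fun j => le_of_eq ?_
  have hl : Module.length R (A ⟶ X⟦n + j⟧) = Module.length R (A ⟶ (X⟦n⟧)⟦j⟧) :=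
    (homPostcompEquiv R A ((shiftFunctorAdd C n j).app X)).length_eq
  rw [← mul_assoc, ← ENNReal.ofReal_mul (Real.exp_pos _).le, ← Real.exp_add, ← hl]
  congr 4
  rw [Equiv.coe_addLeft]
  push_cast
  ring

/-- A lower bound on the growth of the complexities `δ_t(G, Φ^e G)`, for every split generator
`G`, from one on the weighted lengths along the orbit of a single object `Y`. -/
lemma isBigOmega_of_weightedLength [IsTriangulated C] (t : ℝ) (A : C)
    (hA : ∀ Z : C, weightedLength R t A Z ≠ ∞) (Φ : C ⥤ C) [Φ.CommShift ℤ] [Φ.IsTriangulated]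
    (Y : C) {b : ℕ → ℝ} (hY : IsBigOmega (fun e => weightedLength R t A (Φ.obj^[e] Y)) b)
    (G : C) (hG : IsSplitGenerator G) :
    IsBigOmega (fun e => complexity t G (Φ.obj^[e] G)) b := by
  obtain ⟨c, hc, hev⟩ := hY
  set K : ℝ≥0∞ := complexity t G Y * weightedLength R t A G with hK
  have hKtop : K ≠ ∞ := ENNReal.mul_ne_top (complexity_ne_top hG t Y) (hA G)
  refine ⟨c / (K.toReal + 1), by positivity, hev.mono fun e he => ?_⟩
  have h1 := le_complexity_mul (t := t) (weightedLength R t A) (weightedLength_triangle R t A)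
    (weightedLength_retract R t A) (weightedLength_shift R t A) G (Φ.obj^[e] Y) (hA G)
    (complexity_ne_top hG t _)
  have h2 := complexity_map_iterate_le Φ t G Y e
  have h3 : complexity t G (Φ.obj^[e] Y) ≤ complexity t G (Φ.obj^[e] G) * complexity t G Y :=
    (complexity_mul_le (complexity_ne_top hG t _)
      (ne_top_of_le_ne_top (complexity_ne_top hG t _) h2)).trans (by gcongr)
  have h4 : ENNReal.ofReal (c * b e) ≤ complexity t G (Φ.obj^[e] G) * K := by
    refine he.trans (h1.trans ?_)
    rw [hK, ← mul_assoc]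
    gcongr
  have h5 : c * b e ≤ (complexity t G (Φ.obj^[e] G)).toReal * K.toReal := by
    rw [← ENNReal.toReal_mul]
    exact (ENNReal.ofReal_le_iff_le_toReal
      (ENNReal.mul_ne_top (complexity_ne_top hG t _) hKtop)).1 h4
  refine (ENNReal.ofReal_le_iff_le_toReal (complexity_ne_top hG t _)).2 ?_
  rw [div_mul_eq_mul_div, div_le_iff₀ (by positivity)]
  nlinarith [ENNReal.toReal_nonneg (a := complexity t G (Φ.obj^[e] G))]

/-! ### Cones of multiplication by ring elements -/

section Cone

variable {R} {A K : C} {x : R} {g : A ⟶ K} {h : K ⟶ A⟦(1 : ℤ)⟧}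

lemma smul_mor₂_of_distTriang (hT : Triangle.mk (x • 𝟙 A) g h ∈ distTriang C) : x • g = 0 := by
  have : (x • 𝟙 A) ≫ g = 0 := comp_distTriang_mor_zero₁₂ _ hT
  rwa [Linear.smul_comp, Category.id_comp] at this

lemma exists_eq_comp_of_distTriang (hT : Triangle.mk (x • 𝟙 A) g h ∈ distTriang C) {W : C}
    (f : K ⟶ W) (hf : g ≫ f = 0) : ∃ k : A⟦(1 : ℤ)⟧ ⟶ W, f = h ≫ k :=
  Triangle.yoneda_exact₃ _ hT f hf

lemma leftComp_exact_of_distTriang (hT : Triangle.mk (x • 𝟙 A) g h ∈ distTriang C) (W : C) :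
    LinearMap.range (Linear.leftComp R W h) = LinearMap.ker (Linear.leftComp R W g) := by
  ext f
  constructor
  · rintro ⟨k, rfl⟩
    have h0 : g ≫ h = 0 := comp_distTriang_mor_zero₂₃ _ hT
    rw [LinearMap.mem_ker, Linear.leftComp_apply, Linear.leftComp_apply, ← Category.assoc, h0,
      zero_comp]
  · intro hf
    obtain ⟨k, hk⟩ := exists_eq_comp_of_distTriang hT f hf
    exact ⟨k, hk.symm⟩

variable [∀ n : ℤ, (shiftFunctor C n).Linear R]

lemma exists_smul_of_comp_eq_zero (hT : Triangle.mk (x • 𝟙 A) g h ∈ distTriang C) {W : C}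
    (k : A⟦(1 : ℤ)⟧ ⟶ W) (hk : h ≫ k = 0) : ∃ k' : A⟦(1 : ℤ)⟧ ⟶ W, k = x • k' := by
  obtain ⟨k', hk'⟩ : ∃ k' : A⟦(1 : ℤ)⟧ ⟶ W, k = (-(x • 𝟙 A)⟦(1 : ℤ)⟧') ≫ k' :=
    Triangle.yoneda_exact₂ _ (rot_of_distTriang _ (rot_of_distTriang _ hT)) k hk
  refine ⟨-k', ?_⟩
  rw [hk', Functor.map_smul, CategoryTheory.Functor.map_id, Preadditive.neg_comp,
    Linear.smul_comp, Category.id_comp, smul_neg]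

/-- The linear equivalence `Hom (A, W[i]) ≃ Hom (A[1], W[i + 1])`. -/
def homShiftEquiv (R : Type*) [CommRing R] [Linear R C] [∀ n : ℤ, (shiftFunctor C n).Linear R]
    (A W : C) (i j : ℤ) (hij : i + 1 = j) :
    (A ⟶ W⟦i⟧) ≃ₗ[R] (A⟦(1 : ℤ)⟧ ⟶ W⟦j⟧) :=
  (LinearEquiv.ofBijective ((shiftFunctor C (1 : ℤ)).mapLinearMap R)
    ⟨(shiftFunctor C (1 : ℤ)).map_injective, (shiftFunctor C (1 : ℤ)).map_surjective⟩).trans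
    (homPostcompEquiv R _ ((shiftFunctorAdd' C i 1 j hij).symm.app W))

lemma isNoetherian_hom_cone (hT : Triangle.mk (x • 𝟙 A) g h ∈ distTriang C)
    (hA : ∀ (Z : C) (j : ℤ), IsNoetherian R (A ⟶ Z⟦j⟧)) (Z : C) (j : ℤ) :
    IsNoetherian R (K ⟶ Z⟦j⟧) := by
  have := hA Z j
  have := hA Z (j - 1)
  have : IsNoetherian R (A⟦(1 : ℤ)⟧ ⟶ Z⟦j⟧) :=
    isNoetherian_of_linearEquiv (homShiftEquiv R A Z (j - 1) j (by ring))
  exact isNoetherian_of_range_eq_ker _ _ (leftComp_exact_of_distTriang hT _)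

lemma subsingleton_hom_cone (hT : Triangle.mk (x • 𝟙 A) g h ∈ distTriang C) (Z : C) (i j : ℤ)
    (hij : i + 1 = j) (h1 : Subsingleton (A ⟶ Z⟦i⟧)) (h2 : Subsingleton (A ⟶ Z⟦j⟧)) :
    Subsingleton (K ⟶ Z⟦j⟧) := by
  have : Subsingleton (A⟦(1 : ℤ)⟧ ⟶ Z⟦j⟧) := (homShiftEquiv R A Z i j hij).symm.injective.subsingleton
  refine subsingleton_of_forall_eq 0 fun f => ?_
  have hf : f ∈ LinearMap.ker (Linear.leftComp R (Z⟦j⟧) g) := Subsingleton.elim _ _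
  rw [← leftComp_exact_of_distTriang hT] at hf
  obtain ⟨k, rfl⟩ := hf
  rw [Subsingleton.elim k 0, map_zero]

omit [HasZeroObject C] [HasShift C ℤ] [∀ n : ℤ, (shiftFunctor C n).Additive] [Pretriangulated C]
  [∀ n : ℤ, (shiftFunctor C n).Linear R] in
lemma smul_eq_zero_of_smul_id {y : R} (hy : y • 𝟙 A = 0) {W : C} (f : A ⟶ W) : y • f = 0 := by
  rw [← Category.id_comp f, ← Linear.smul_comp, hy, zero_comp]

/-- If `y` kills `A`, then `y ^ 2` kills the cone of any `x : A ⟶ A`. -/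
lemma sq_smul_id_cone (hT : Triangle.mk (x • 𝟙 A) g h ∈ distTriang C) {y : R}
    (hy : y • 𝟙 A = 0) : y ^ 2 • 𝟙 K = 0 := by
  have h1 : y • g = 0 := smul_eq_zero_of_smul_id hy g
  obtain ⟨k, hk⟩ := exists_eq_comp_of_distTriang hT (y • 𝟙 K) (by simp [h1])
  have h2 : y • 𝟙 (A⟦(1 : ℤ)⟧) = 0 := by
    rw [← CategoryTheory.Functor.map_id, ← Functor.map_smul, hy, Functor.map_zero]
  rw [pow_two, mul_smul, hk, ← Linear.comp_smul, smul_eq_zero_of_smul_id h2, comp_zero]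

/-- The square of `x` kills the cone of `x : A ⟶ A`. -/
lemma sq_smul_id_cone_self (hT : Triangle.mk (x • 𝟙 A) g h ∈ distTriang C) :
    x ^ 2 • 𝟙 K = 0 := by
  have h1 : x • g = 0 := smul_mor₂_of_distTriang hT
  obtain ⟨k, hk⟩ := exists_eq_comp_of_distTriang hT (x • 𝟙 K) (by simp [h1])
  have h2 : x • h = 0 := by
    have h3 : h ≫ (x • 𝟙 A)⟦(1 : ℤ)⟧' = 0 := comp_distTriang_mor_zero₃₁ _ hT
    rwa [Functor.map_smul, CategoryTheory.Functor.map_id, Linear.comp_smul,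
      Category.comp_id] at h3
  rw [pow_two, mul_smul, hk, ← Linear.smul_comp, h2, zero_comp]

/-- A surjection from `Hom (A, M[i])` onto a module killed by `x` induces one from
`Hom (K, M[i + 1])`, where `K` is the cone of `x : A ⟶ A`, provided that `Hom (A, M[i + 1])`
vanishes. -/
lemma exists_surjective_hom_cone (hT : Triangle.mk (x • 𝟙 A) g h ∈ distTriang C) (M : C) (i j : ℤ)
    (hij : i + 1 = j) (hA : Subsingleton (A ⟶ M⟦j⟧)) {N : Type*} [AddCommGroup N] [Module R N]
    (hN : ∀ n : N, x • n = 0) (φ : (A ⟶ M⟦i⟧) →ₗ[R] N) (hφ : Function.Surjective φ) :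
    ∃ ψ : (K ⟶ M⟦j⟧) →ₗ[R] N, Function.Surjective ψ := by
  let φ' : (A⟦(1 : ℤ)⟧ ⟶ M⟦j⟧) →ₗ[R] N := φ ∘ₗ (homShiftEquiv R A M i j hij).symm.toLinearMap
  have hφ' : Function.Surjective φ' := hφ.comp (homShiftEquiv R A M i j hij).symm.surjective
  let γ := Linear.leftComp R (M⟦j⟧) h
  have hγ : Function.Surjective γ := by
    intro f
    have hf : f ∈ LinearMap.ker (Linear.leftComp R (M⟦j⟧) g) := Subsingleton.elim _ _
    rwa [← leftComp_exact_of_distTriang hT] at hf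
  have hker : LinearMap.ker γ ≤ LinearMap.ker φ' := by
    intro k hk
    obtain ⟨k', rfl⟩ := exists_smul_of_comp_eq_zero hT k hk
    rw [LinearMap.mem_ker, map_smul, hN]
  refine ⟨(LinearMap.ker γ).liftQ φ' hker ∘ₗ
    (γ.quotKerEquivOfSurjective hγ).symm.toLinearMap, ?_⟩
  refine Function.Surjective.comp (g := (LinearMap.ker γ).liftQ φ' hker) ?_
    (γ.quotKerEquivOfSurjective hγ).symm.surjective
  intro n
  obtain ⟨k, rfl⟩ := hφ' n
  exact ⟨(LinearMap.ker γ).mkQ k, by simp⟩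

end Cone

end Linear

/-! ### Koszul objects -/

section KoszulObject

variable {R : Type u} [CommRing R] {C : Type*} [Category* C] [HasZeroObject C] [HasShift C ℤ]
  [Preadditive C] [∀ n : ℤ, (shiftFunctor C n).Additive] [Pretriangulated C] [Linear R C]
  [∀ n : ℤ, (shiftFunctor C n).Linear R]

/-- The Koszul object obtained from `B` by taking successive cones of the elements of `l`.
Finiteness and boundedness of the morphisms out of `B` are inherited, powers of the elements of `l`
act as zero, and a quotient of `Hom (B, M)` killed by `l` is a quotient of `Hom (A, M[r])` when
`Hom (B, M[j]) = 0` for `j > 0`; here `r` is the length of `l`. -/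
lemma exists_koszulObject (B : C) (hN : ∀ (Z : C) (j : ℤ), IsNoetherian R (B ⟶ Z⟦j⟧))
    (hB : ∀ Z : C, ∃ n : ℕ, ∀ j : ℤ, (n : ℤ) < |j| → Subsingleton (B ⟶ Z⟦j⟧)) (l : List R) :
    ∃ A : C, (∀ (Z : C) (j : ℤ), IsNoetherian R (A ⟶ Z⟦j⟧)) ∧
      (∀ Z : C, ∃ n : ℕ, ∀ j : ℤ, (n : ℤ) < |j| → Subsingleton (A ⟶ Z⟦j⟧)) ∧
      (∀ x ∈ l, ∃ n : ℕ, x ^ n • 𝟙 A = 0) ∧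
      ∀ (M : C), (∀ j : ℤ, 0 < j → Subsingleton (B ⟶ M⟦j⟧)) →
        (∀ j : ℤ, l.length < j → Subsingleton (A ⟶ M⟦j⟧)) ∧
        ∀ (N : Type u) [AddCommGroup N] [Module R N] (φ : (B ⟶ M⟦(0 : ℤ)⟧) →ₗ[R] N),
          Function.Surjective φ → (∀ x ∈ l, ∀ n : N, x • n = 0) →
          ∃ ψ : (A ⟶ M⟦(l.length : ℤ)⟧) →ₗ[R] N, Function.Surjective ψ := by
  induction l with
  | nil =>
    refine ⟨B, hN, hB, by simp, fun M hM => ⟨by simpa using hM, fun N _ _ φ hφ _ => ⟨φ, hφ⟩⟩⟩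
  | cons x l ih =>
    obtain ⟨A, hAN, hAB, hA0, hAM⟩ := ih
    obtain ⟨K, g, h, hT⟩ := distinguished_cocone_triangle (x • 𝟙 A)
    refine ⟨K, isNoetherian_hom_cone hT hAN, fun Z => ?_, ?_, fun M hM => ⟨fun j hj => ?_, ?_⟩⟩
    · obtain ⟨n, hn⟩ := hAB Z
      refine ⟨n + 1, fun j hj => subsingleton_hom_cone hT Z (j - 1) j (by ring) (hn _ ?_) (hn _ ?_)⟩
      · have := abs_sub_abs_le_abs_sub j 1
        push_cast at hj
        rw [abs_one] at this
        lia
      · push_cast at hj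
        lia
    · intro y hy
      rcases List.mem_cons.1 hy with rfl | hy
      · exact ⟨2, sq_smul_id_cone_self hT⟩
      · obtain ⟨n, hn⟩ := hA0 y hy
        refine ⟨n * 2, ?_⟩
        rw [pow_mul]
        exact sq_smul_id_cone hT hn
    · rw [List.length_cons] at hj
      push_cast at hj
      exact subsingleton_hom_cone hT M (j - 1) j (by ring) ((hAM M hM).1 _ (by lia))
        ((hAM M hM).1 _ (by lia))
    · intro N _ _ φ hφ hN0
      obtain ⟨ψ, hψ⟩ := (hAM M hM).2 N φ hφ fun y hy => hN0 y (List.mem_cons_of_mem _ hy)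
      exact exists_surjective_hom_cone hT M (l.length : ℤ) ((x :: l).length : ℤ)
        (by simp) ((hAM M hM).1 _ (by simp)) (hN0 x List.mem_cons_self) ψ hψ

omit [HasZeroObject C] [∀ n : ℤ, (shiftFunctor C n).Additive] [Pretriangulated C]
  [∀ n : ℤ, (shiftFunctor C n).Linear R] in
lemma weightedLength_ne_top (t : ℝ) (A Z : C) (hl : ∀ j : ℤ, Module.length R (A ⟶ Z⟦j⟧) ≠ ⊤)
    (hb : ∃ n : ℕ, ∀ j : ℤ, (n : ℤ) < |j| → Subsingleton (A ⟶ Z⟦j⟧)) :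
    weightedLength R t A Z ≠ ∞ := by
  obtain ⟨n, hn⟩ := hb
  rw [weightedLength, tsum_eq_sum (s := Finset.Icc (-n : ℤ) n)]
  · refine ENNReal.sum_ne_top.2 fun j _ => ENNReal.mul_ne_top ENNReal.ofReal_ne_top ?_
    exact ENat.toENNReal_ne_top.2 (hl j)
  · intro j hj
    have : Subsingleton (A ⟶ Z⟦j⟧) := hn j <| by
      rw [Finset.mem_Icc, ← abs_le] at hj
      exact not_le.1 hj
    rw [Module.length_eq_zero, ENat.toENNReal_zero, mul_zero]

end KoszulObject

/-! ### Finite length over a local ring, and the growth of `ℓ (R ⧸ 𝔪 ^ n)` -/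

section Local

variable {R : Type*} [CommRing R] [IsNoetherianRing R] [IsLocalRing R]

open IsLocalRing

lemma isArtinianRing_quotient_maximalIdeal_pow (n : ℕ) :
    IsArtinianRing (R ⧸ maximalIdeal R ^ n) := by
  have hprime : ∀ P : Ideal (R ⧸ maximalIdeal R ^ n), P.IsPrime → P.IsMaximal := by
    intro P hP
    have hP' := hP.comap (Ideal.Quotient.mk (maximalIdeal R ^ n))
    have hle : maximalIdeal R ≤ P.comap (Ideal.Quotient.mk (maximalIdeal R ^ n)) := by
      refine hP'.le_of_pow_le (n := n) fun x hx => ?_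
      rw [Ideal.mem_comap, Ideal.Quotient.eq_zero_iff_mem.2 hx]
      exact P.zero_mem
    have hmax : (P.comap (Ideal.Quotient.mk (maximalIdeal R ^ n))).IsMaximal := by
      rw [← (maximalIdeal.isMaximal R).eq_of_le hP'.ne_top hle]
      exact maximalIdeal.isMaximal R
    have h := Ideal.map_eq_top_or_isMaximal_of_surjective (Ideal.Quotient.mk (maximalIdeal R ^ n))
      Ideal.Quotient.mk_surjective hmax
    rw [Ideal.map_comap_of_surjective _ Ideal.Quotient.mk_surjective] at h
    exact h.resolve_left hP.ne_top
  have : Ring.KrullDimLE 0 (R ⧸ maximalIdeal R ^ n) := .mk₀ hprime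
  exact isArtinianRing_iff_isNoetherianRing_krullDimLE_zero.2 ⟨inferInstance, this⟩

/-- A finitely generated module killed by a power of the maximal ideal has finite length. -/
lemma isFiniteLength_of_maximalIdeal_pow {M : Type*} [AddCommGroup M] [Module R M]
    [Module.Finite R M] {n : ℕ} (h : ∀ x ∈ maximalIdeal R ^ n, ∀ y : M, x • y = 0) :
    IsFiniteLength R M := by
  have hM : Module.IsTorsionBySet R M (maximalIdeal R ^ n : Ideal R) :=
    fun y x => h x.1 x.2 y
  let _ := hM.module
  have : IsScalarTower R (R ⧸ maximalIdeal R ^ n) M := hM.isScalarTower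
  have := isArtinianRing_quotient_maximalIdeal_pow (R := R) n
  have : Module.Finite (R ⧸ maximalIdeal R ^ n) M := .of_restrictScalars_finite R _ _
  have : IsArtinian (R ⧸ maximalIdeal R ^ n) M := isArtinian_of_fg_of_artinian'
  have : IsArtinian R M :=
    isArtinian_of_surjective_algebraMap (R := R ⧸ maximalIdeal R ^ n) Ideal.Quotient.mk_surjective
  exact isFiniteLength_iff_isNoetherian_isArtinian.2 ⟨inferInstance, this⟩

lemma isFiniteLength_of_span_eq_maximalIdeal {M : Type*} [AddCommGroup M] [Module R M]
    [Module.Finite R M] (l : List R) (hl : Ideal.span {x | x ∈ l} = maximalIdeal R)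
    (h : ∀ x ∈ l, ∃ n : ℕ, ∀ y : M, x ^ n • y = 0) : IsFiniteLength R M := by
  have hle : maximalIdeal R ≤ (Module.annihilator R M).radical := by
    rw [← hl, Ideal.span_le]
    intro x hx
    obtain ⟨n, hn⟩ := h x hx
    exact ⟨n, Module.mem_annihilator.2 hn⟩
  obtain ⟨n, hn⟩ := Ideal.exists_pow_le_of_le_radical_of_fg hle (IsNoetherian.noetherian _)
  exact isFiniteLength_of_maximalIdeal_pow (n := n)
    fun x hx y => Module.mem_annihilator.1 (hn hx) y

omit [IsNoetherianRing R] [IsLocalRing R] in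
/-- Artin–Rees: modulo a prime `p`, multiplication by `x ∉ p` shifts the `I`-adic filtration by a
bounded amount. -/
lemma exists_mem_sup_pow_of_mul_mem [IsNoetherianRing R] (I p : Ideal R) [p.IsPrime] {x : R}
    (hx : x ∉ p) : ∃ a : ℕ, 0 < a ∧ ∀ (n : ℕ) (r : R), x * r ∈ p ⊔ I ^ n → r ∈ p ⊔ I ^ (n - a) := by
  obtain ⟨a, ha⟩ := Ideal.exists_pow_inf_eq_pow_smul I (M := R ⧸ p)
    (LinearMap.range (LinearMap.lsmul R (R ⧸ p) x))
  have hmem : ∀ (n : ℕ) (r : R), Ideal.Quotient.mk p r ∈ (I ^ n • ⊤ : Submodule R (R ⧸ p)) ↔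
      r ∈ p ⊔ I ^ n := by
    intro n r
    have h1 : (I ^ n • ⊤ : Submodule R (R ⧸ p)) = Submodule.map p.mkQ (I ^ n) := by
      rw [← Submodule.range_mkQ p, ← Submodule.map_top, ← Submodule.map_smul'', smul_eq_mul,
        Ideal.mul_top]
    rw [h1, ← Submodule.comap_map_mkQ, Submodule.mem_comap]
    rfl
  refine ⟨a + 1, a.succ_pos, fun n r hr => ?_⟩
  have hle : p ⊔ I ^ (n - a) ≤ p ⊔ I ^ (n - (a + 1)) :=
    sup_le_sup_left (Ideal.pow_le_pow_right (by lia)) p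
  refine hle ?_
  rcases lt_or_ge n a with hn | hn
  · rw [Nat.sub_eq_zero_of_le hn.le, pow_zero, Ideal.one_eq_top, sup_top_eq]
    trivial
  · rw [← hmem] at hr ⊢
    have h2 : Ideal.Quotient.mk p (x * r) ∈
        (I ^ n • ⊤ ⊓ LinearMap.range (LinearMap.lsmul R (R ⧸ p) x) : Submodule R (R ⧸ p)) :=
      ⟨hr, Ideal.Quotient.mk p r, rfl⟩
    rw [ha n hn] at h2
    have h3 := smul_mono_right (I ^ (n - a))
      (inf_le_right : I ^ a • ⊤ ⊓ LinearMap.range (LinearMap.lsmul R (R ⧸ p) x) ≤ _) h2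
    rw [← Submodule.map_top, ← Submodule.map_smul''] at h3
    obtain ⟨y, hy, hyx⟩ := h3
    obtain ⟨s, rfl⟩ := Ideal.Quotient.mk_surjective y
    -- multiplication by `x` is injective on the domain `R ⧸ p`
    have h4 : x * s - x * r ∈ p := Ideal.Quotient.eq.1 hyx
    rw [← mul_sub] at h4
    have h5 := (Ideal.IsPrime.mem_or_mem ‹_› h4).resolve_left hx
    rwa [← Ideal.Quotient.eq.2 h5]

omit [IsNoetherianRing R] [IsLocalRing R] in
lemma length_quotient_antitone {I J : Ideal R} (h : I ≤ J) :
    Module.length R (R ⧸ J) ≤ Module.length R (R ⧸ I) :=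
  Module.length_le_of_surjective (Submodule.factor h) (Submodule.factor_surjective h)

omit [IsNoetherianRing R] [IsLocalRing R] in
lemma length_quotient_add_le (J K : Ideal R) (x : R) (hK : ∀ r, x * r ∈ J → r ∈ K) :
    Module.length R (R ⧸ K) + Module.length R (R ⧸ (J ⊔ Ideal.span {x})) ≤
      Module.length R (R ⧸ J) := by
  let f : R →ₗ[R] R ⧸ J := J.mkQ ∘ₗ LinearMap.lsmul R R x
  have hker : LinearMap.ker f ≤ K := by
    intro r hr
    refine hK r ((Submodule.Quotient.mk_eq_zero J).1 hr)
  have hle : J ≤ J ⊔ Ideal.span {x} := le_sup_left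
  have hex : Function.Exact ((LinearMap.ker f).liftQ f le_rfl) (Submodule.factor hle) := by
    rw [LinearMap.exact_iff, Submodule.range_liftQ]
    ext y
    obtain ⟨r, rfl⟩ := Submodule.mkQ_surjective _ y
    rw [LinearMap.mem_ker, ← LinearMap.comp_apply, Submodule.factor_comp_mk, Submodule.mkQ_apply,
      Submodule.Quotient.mk_eq_zero, Submodule.mem_sup]
    constructor
    · rintro ⟨j, hj, y, hy, rfl⟩
      obtain ⟨s, rfl⟩ := Ideal.mem_span_singleton'.1 hy
      refine ⟨s, ?_⟩
      change J.mkQ (x * s) = _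
      rw [map_add, Submodule.mkQ_apply, Submodule.mkQ_apply, Submodule.mkQ_apply,
        (Submodule.Quotient.mk_eq_zero J).2 hj, zero_add, mul_comm]
    · rintro ⟨s, hs⟩
      have hs : J.mkQ (x * s) = J.mkQ r := hs
      refine ⟨r - x * s, (Submodule.Quotient.eq J).1 hs.symm, x * s,
        Ideal.mem_span_singleton.2 (dvd_mul_right _ _), by ring⟩
  rw [Module.length_eq_add_of_exact _ _
    (LinearMap.ker_eq_bot.1 (Submodule.ker_liftQ_eq_bot' _ _ rfl))
    (Submodule.factor_surjective hle) hex]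
  exact add_le_add_left (length_quotient_antitone hker) _

lemma pow_succ_le_add (a m : ℝ) (ha : 0 ≤ a) (hm : 0 ≤ m) (d : ℕ) :
    (m + a) ^ (d + 1) ≤ m ^ (d + 1) + (d + 1) * a * (m + a) ^ d := by
  induction d with
  | zero => simp
  | succ d ih =>
    have h1 : m ^ (d + 1) ≤ (m + a) ^ (d + 1) := by gcongr; linarith
    calc (m + a) ^ (d + 1 + 1) = (m + a) * (m + a) ^ (d + 1) := by ring
      _ ≤ (m + a) * (m ^ (d + 1) + (d + 1) * a * (m + a) ^ d) := by gcongr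
      _ = m ^ (d + 1 + 1) + a * m ^ (d + 1) + (d + 1) * a * (m + a) ^ (d + 1) := by ring
      _ ≤ m ^ (d + 1 + 1) + a * (m + a) ^ (d + 1) + (d + 1) * a * (m + a) ^ (d + 1) := by gcongr
      _ = _ := by push_cast; ring

/-- A sequence whose increments over a bounded step grow at least like `n ^ d` grows at least like
`n ^ (d + 1)`. -/
lemma exists_pow_succ_le_of_add_le (L L' : ℕ → ℝ≥0∞) {a : ℕ} (ha0 : 0 < a) (d : ℕ)
    {c : ℝ} (hc : 0 < c)
    (hL : ∀ n, L (n - a) + L' n ≤ L n) (hL' : ∀ n : ℕ, 1 ≤ n → ENNReal.ofReal (c * n ^ d) ≤ L' n) :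
    ∃ c' : ℝ, 0 < c' ∧ ∀ n : ℕ, 1 ≤ n → ENNReal.ofReal (c' * n ^ (d + 1)) ≤ L n := by
  have ha : (0 : ℝ) < (d + 1) * a := by positivity
  refine ⟨c / ((d + 1) * a), by positivity, fun n => ?_⟩
  induction n using Nat.strong_induction_on with
  | _ n ih =>
    intro hn
    have hn0 : (0 : ℝ) ≤ n := Nat.cast_nonneg n
    have h1 := hL' n hn
    rcases le_or_gt n a with hna | hna
    · refine le_trans (ENNReal.ofReal_le_ofReal ?_) (h1.trans (le_add_self.trans (hL n)))
      rw [div_mul_eq_mul_div, div_le_iff₀ ha, pow_succ]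
      have hna' : (n : ℝ) ≤ a := by exact_mod_cast hna
      have h2 : (n : ℝ) ≤ (d + 1) * a := by nlinarith [Nat.cast_nonneg (α := ℝ) d]
      nlinarith [mul_le_mul_of_nonneg_left h2 (by positivity : 0 ≤ c * (n : ℝ) ^ d)]
    · have h2 := ih (n - a) (by lia) (by lia)
      refine le_trans ?_ ((add_le_add h2 h1).trans (hL n))
      rw [← ENNReal.ofReal_add (by positivity) (by positivity)]
      refine ENNReal.ofReal_le_ofReal ?_
      have h3 := pow_succ_le_add a ((n - a : ℕ) : ℝ) (by positivity) (by positivity) d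
      rw [Nat.cast_sub hna.le, sub_add_cancel] at h3
      rw [Nat.cast_sub hna.le, div_mul_eq_mul_div, div_mul_eq_mul_div, div_add' _ _ _ ha.ne',
        div_le_div_iff_of_pos_right ha]
      nlinarith

/-- The lower bound in the theory of the Hilbert–Samuel function: if `V (I)` contains a chain of
`d + 1` primes, then `ℓ (R ⧸ (I + 𝔪 ^ n))` grows at least like `n ^ d`. -/
lemma exists_pow_le_length_quotient_sup (d : ℕ) : ∀ (s : LTSeries (PrimeSpectrum R)),
    s.length = d → ∃ c : ℝ, 0 < c ∧ ∀ n : ℕ, 1 ≤ n → ENNReal.ofReal (c * n ^ d) ≤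
      (Module.length R (R ⧸ (s.head.asIdeal ⊔ maximalIdeal R ^ n)) : ℝ≥0∞) := by
  induction d with
  | zero =>
    intro s hs
    refine ⟨1, one_pos, fun n hn => ?_⟩
    have hle : s.head.asIdeal ⊔ maximalIdeal R ^ n ≤ maximalIdeal R :=
      sup_le (le_maximalIdeal s.head.isPrime.ne_top) (Ideal.pow_le_self (by lia))
    have : Nontrivial (R ⧸ (s.head.asIdeal ⊔ maximalIdeal R ^ n)) :=
      Ideal.Quotient.nontrivial_iff.2 fun h =>
        (maximalIdeal.isMaximal R).ne_top (top_le_iff.1 (h ▸ hle))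
    have h1 : 1 ≤ Module.length R (R ⧸ (s.head.asIdeal ⊔ maximalIdeal R ^ n)) :=
      Order.one_le_iff_pos.2 Module.length_pos
    simpa using ENat.toENNReal_le.2 h1
  | succ d ih =>
    intro s hs
    have hs0 : s.length ≠ 0 := by lia
    have : NeZero s.length := ⟨hs0⟩
    let s' := s.tail hs0
    have hlt : s.head < s'.head := by
      rw [RelSeries.head_tail]
      exact s.strictMono (by
        rw [Fin.lt_def, Fin.val_zero, Fin.val_one', Nat.mod_eq_of_lt (by lia)]
        exact one_pos)
    obtain ⟨c, hc, h⟩ := ih s' (by simp [s', hs])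
    -- `x` lies in the second prime `p'` of the chain but not in the first prime `p`. Multiplication
    -- by `x` compares `R ⧸ (p + 𝔪 ^ n)` with `R ⧸ (p + 𝔪 ^ (n - a))`, and the difference of the
    -- lengths is at least `ℓ (R ⧸ (p' + 𝔪 ^ n))`.
    obtain ⟨x, hx', hx⟩ := SetLike.exists_of_lt (show s.head.asIdeal < s'.head.asIdeal from hlt)
    obtain ⟨a, ha0, ha⟩ := exists_mem_sup_pow_of_mul_mem (maximalIdeal R) s.head.asIdeal hx
    refine exists_pow_succ_le_of_add_le
      (fun n => (Module.length R (R ⧸ (s.head.asIdeal ⊔ maximalIdeal R ^ n)) : ℝ≥0∞))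
      (fun n => (Module.length R (R ⧸ (s'.head.asIdeal ⊔ maximalIdeal R ^ n)) : ℝ≥0∞))
      ha0 d hc (fun n => ?_) h
    rw [← ENat.toENNReal_add, ENat.toENNReal_le]
    refine le_trans (add_le_add_right (length_quotient_antitone ?_) _)
      (length_quotient_add_le _ _ x (ha n))
    refine sup_le (sup_le_sup_right hlt.le _) ?_
    rw [Ideal.span_singleton_le_iff_mem]
    exact Ideal.mem_sup_left hx'

/-- In dimension at least `d`, the length of `R ⧸ 𝔪 ^ n` grows at least like `n ^ d`. -/
lemma exists_pow_le_length_quotient {d : ℕ} (hd : (d : WithBot ℕ∞) ≤ ringKrullDim R) :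
    ∃ c : ℝ, 0 < c ∧ ∀ n : ℕ, 1 ≤ n → ENNReal.ofReal (c * n ^ d) ≤
      (Module.length R (R ⧸ maximalIdeal R ^ n) : ℝ≥0∞) := by
  obtain ⟨s, hs⟩ := Order.le_krullDim_iff.1 hd
  obtain ⟨c, hc, h⟩ := exists_pow_le_length_quotient_sup d s hs
  refine ⟨c, hc, fun n hn => (h n hn).trans ?_⟩
  exact ENat.toENNReal_le.2 (length_quotient_antitone le_sup_right)

end Local

/-! ### Restriction of scalars along a local endomorphism -/

section Restriction

variable {R : Type u} [CommRing R]

/-- The module `φ^e_* N`, obtained from `N` by restricting scalars `e` times along `φ`. -/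
def restrictIter (φ : R →+* R) : ℕ → ModuleCat.{u} R → ModuleCat.{u} R
  | 0, N => N
  | e + 1, N => (ModuleCat.restrictScalars.{u} φ).obj (restrictIter φ e N)

lemma exists_surjective_restrictIter (φ : R →+* R) (e : ℕ) {M N : ModuleCat.{u} R}
    (f : M →ₗ[R] N) (hf : Function.Surjective f) :
    ∃ g : restrictIter φ e M →ₗ[R] restrictIter φ e N, Function.Surjective g := by
  induction e with
  | zero => exact ⟨f, hf⟩
  | succ e ih =>
    obtain ⟨g, hg⟩ := ih
    exact ⟨((ModuleCat.restrictScalars φ).map (ModuleCat.ofHom g)).hom, hg⟩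

/-- If `φ` maps an ideal `I` into `I ^ q`, then `φ^e_*` turns modules killed by `I ^ (j q ^ e)`
into modules killed by `I ^ j`. -/
lemma restrictIter_smul_eq_zero (φ : R →+* R) {I : Ideal R} {q : ℕ} (hI : I.map φ ≤ I ^ q)
    (N : ModuleCat.{u} R) (e : ℕ) : ∀ j : ℕ, (∀ r ∈ I ^ (j * q ^ e), ∀ n : N, r • n = 0) →
      ∀ r ∈ I ^ j, ∀ n : restrictIter φ e N, r • n = 0 := by
  induction e with
  | zero =>
    intro j h r hr
    rw [pow_zero, mul_one] at h
    exact h r hr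
  | succ e ih =>
    intro j h r hr
    have h1 := ih (j * q) (by rwa [mul_assoc, ← pow_succ'])
    have h2 : φ r ∈ I ^ (j * q) := by
      rw [mul_comm, pow_mul]
      refine Ideal.pow_right_mono hI j ?_
      rw [← Ideal.map_pow]
      exact Ideal.mem_map_of_mem φ hr
    exact fun n => h1 (φ r) h2 n

variable [IsLocalRing R]

open IsLocalRing

lemma length_restrictScalars_residueField (φ : R →+* R) [IsLocalHom φ]
    (hφ : φ.Finite) : Module.length R ((ModuleCat.restrictScalars.{u} φ).obj
      (ModuleCat.of R (R ⧸ maximalIdeal R))) = residueDegree φ := by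
  let X := (ModuleCat.restrictScalars (ResidueField.map φ)).obj
    (ModuleCat.of (ResidueField R) (ResidueField R))
  let Y := (ModuleCat.restrictScalars.{u} φ).obj (ModuleCat.of R (R ⧸ maximalIdeal R))
  have hY : Module.Finite R Y :=
    ((fgPushforward φ hφ).obj (FGModuleCat.of R (R ⧸ maximalIdeal R))).property
  let _ : Module (ResidueField R) Y := X.isModule
  have : IsScalarTower R (ResidueField R) Y := by
    refine ⟨fun r c y => ?_⟩
    obtain ⟨c, rfl⟩ := residue_surjective c
    obtain ⟨y, rfl⟩ := Ideal.Quotient.mk_surjective y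
    change Ideal.Quotient.mk (maximalIdeal R) (φ (r * c) * y) =
      Ideal.Quotient.mk (maximalIdeal R) (φ r * (φ c * y))
    rw [map_mul φ, mul_assoc]
  have : Module.Finite (ResidueField R) Y := .of_restrictScalars_finite R _ _
  have h1 : Module.length R Y = Module.length (ResidueField R) Y :=
    Module.length_eq_of_surjective residue_surjective
  exact h1.trans (Module.length_eq_finrank _ _)

lemma residueDegree_pos (φ : R →+* R) [IsLocalHom φ] (hφ : φ.Finite) : 0 < residueDegree φ := by
  have h := length_restrictScalars_residueField φ hφ
  have : Nontrivial ((ModuleCat.restrictScalars.{u} φ).obj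
      (ModuleCat.of R (R ⧸ maximalIdeal R))) := inferInstanceAs (Nontrivial (R ⧸ maximalIdeal R))
  have h1 := Module.length_pos (R := R) (M := (ModuleCat.restrictScalars.{u} φ).obj
      (ModuleCat.of R (R ⧸ maximalIdeal R)))
  rw [h] at h1
  exact_mod_cast h1

/-- Restriction of scalars along `φ` multiplies lengths by `[φ_* k : k]`. -/
lemma length_restrictScalars (φ : R →+* R) [IsLocalHom φ] (hφ : φ.Finite)
    (N : Type u) [AddCommGroup N] [Module R N] (hN : IsFiniteLength R N) :
    Module.length R ((ModuleCat.restrictScalars.{u} φ).obj (ModuleCat.of R N)) =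
      residueDegree φ * Module.length R N := by
  induction hN with
  | of_subsingleton =>
    rename_i M _ _ _
    have : Subsingleton ((ModuleCat.restrictScalars.{u} φ).obj (ModuleCat.of R M)) :=
      inferInstanceAs (Subsingleton M)
    rw [Module.length_eq_zero, Module.length_eq_zero, mul_zero]
  | of_simple_quotient hN ih =>
    rename_i M _ _ N hs
    obtain ⟨I, hI, ⟨e⟩⟩ := isSimpleModule_iff_quot_maximal.1 hs
    obtain rfl := eq_maximalIdeal hI
    have hex : Function.Exact N.subtype (e.toLinearMap ∘ₗ N.mkQ) :=
      (LinearMap.exact_subtype_mkQ N).comp_injective _ e.injective (map_zero e)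
    have h1 := Module.length_eq_add_of_exact
      ((ModuleCat.restrictScalars.{u} φ).map (ModuleCat.ofHom N.subtype)).hom
      ((ModuleCat.restrictScalars.{u} φ).map (ModuleCat.ofHom (e.toLinearMap ∘ₗ N.mkQ))).hom
      (Submodule.subtype_injective N) (e.surjective.comp N.mkQ_surjective) hex
    rw [h1, ih, length_restrictScalars_residueField φ hφ,
      Module.length_eq_add_of_exact N.subtype N.mkQ N.subtype_injective N.mkQ_surjective
        (LinearMap.exact_subtype_mkQ N), Module.length_eq_one (R := R) (M := M ⧸ N), mul_add,
      mul_one]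

lemma length_restrictIter (φ : R →+* R) [IsLocalHom φ] (hφ : φ.Finite)
    (N : Type u) [AddCommGroup N] [Module R N] (hN : IsFiniteLength R N) (e : ℕ) :
    Module.length R (restrictIter φ e (ModuleCat.of R N)) =
      (residueDegree φ : ℕ∞) ^ e * Module.length R N := by
  induction e with
  | zero => rw [pow_zero, one_mul]; rfl
  | succ e ih =>
    have h1 : IsFiniteLength R (restrictIter φ e (ModuleCat.of R N)) := by
      rw [← Module.length_ne_top_iff, ih]
      refine WithTop.mul_ne_top ?_ (Module.length_ne_top_iff.2 hN)
      exact_mod_cast ENat.natCast_ne_top (residueDegree φ ^ e)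
    refine (length_restrictScalars φ hφ _ h1).trans ?_
    rw [ih, pow_succ']
    ring

end Restriction

/-! ### Morphisms out of the free module of rank one -/

section Shift

/-- A faithful linear functor commuting with the shifts reflects linearity of the shift
functors. -/
lemma shiftFunctor_linear_of_faithful (R : Type*) [Ring R] {C D : Type*} [Category* C]
    [Category* D] [Preadditive C] [Preadditive D] [HasShift C ℤ] [HasShift D ℤ] [Linear R C]
    [Linear R D] (F : C ⥤ D) [F.CommShift ℤ] [F.Faithful] [F.Additive] [F.Linear R]
    [∀ n : ℤ, (shiftFunctor D n).Additive] [∀ n : ℤ, (shiftFunctor D n).Linear R] (n : ℤ) :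
    (shiftFunctor C n).Linear R where
  map_smul f r := by
    apply F.map_injective
    have h : ((shiftFunctor C n) ⋙ F).map (r • f) = r • ((shiftFunctor C n) ⋙ F).map f := by
      rw [← cancel_mono ((F.commShiftIso n).hom.app _), Linear.smul_comp, NatTrans.naturality,
        NatTrans.naturality, Functor.comp_map, Functor.comp_map, F.map_smul,
        (shiftFunctor D n).map_smul, Linear.comp_smul]
    exact h.trans (F.map_smul r ((shiftFunctor C n).map f)).symm

end Shift

section Free

variable {R : Type u} [CommRing R]

/-- Evaluation at `1`, as a linear map `Hom (R, M) → M`. -/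
def evalOne (M : FGModuleCat.{u} R) : (FGModuleCat.of R R ⟶ M) →ₗ[R] M where
  toFun f := f.hom.hom (1 : R)
  map_add' _ _ := rfl
  map_smul' _ _ := rfl

lemma evalOne_injective (M : FGModuleCat.{u} R) : Function.Injective (evalOne M) := by
  intro f g h
  apply ObjectProperty.hom_ext
  apply ModuleCat.hom_ext
  exact LinearMap.ext_ring h

lemma evalOne_surjective (M : FGModuleCat.{u} R) : Function.Surjective (evalOne M) := by
  intro m
  exact ⟨ObjectProperty.homMk (ModuleCat.ofHom (LinearMap.toSpanSingleton R M m)),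
    LinearMap.toSpanSingleton_apply_one R M m⟩

variable [IsNoetherianRing R]

instance projective_of_self : Projective (FGModuleCat.of R R) where
  factors {E X} f e _ := by
    have h1 : Epi ((forget₂ (FGModuleCat R) (ModuleCat.{u} R)).map e) := inferInstance
    obtain ⟨y, hy⟩ := (ModuleCat.epi_iff_surjective _).1 h1 (evalOne X f)
    obtain ⟨g, rfl⟩ := evalOne_surjective E y
    exact ⟨g, evalOne_injective X hy⟩

instance isKProjective_single :
    ((CochainComplex.singleFunctor (FGModuleCat.{u} R) 0).obj (FGModuleCat.of R R)).IsKProjective := by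
  have h : ∀ n : ℤ, Projective (((CochainComplex.singleFunctor (FGModuleCat.{u} R) 0).obj
      (FGModuleCat.of R R)).X n) := by
    intro n
    by_cases hn : n = 0
    · subst hn
      exact Projective.of_iso (HomologicalComplex.singleObjXSelf (ComplexShape.up ℤ) 0
        (FGModuleCat.of R R)).symm inferInstance
    · exact Projective.of_iso (HomologicalComplex.isZero_single_obj_X (ComplexShape.up ℤ) 0
        (FGModuleCat.of R R) n hn).isoZero.symm inferInstance
  exact CochainComplex.isKProjective_of_projective _ 0

variable (R) in
/-- The complex with the free module of rank one in degree zero. -/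
abbrev freeComplex : CochainComplex (FGModuleCat.{u} R) ℤ :=
  (CochainComplex.singleFunctor (FGModuleCat.{u} R) 0).obj (FGModuleCat.of R R)

variable (R) in
/-- The free module of rank one as the degree zero term of `freeComplex R`. -/
def freeComplexXZero : FGModuleCat.of R R ≅ (freeComplex R).X 0 :=
  (HomologicalComplex.singleObjXSelf (ComplexShape.up ℤ) 0 (FGModuleCat.of R R)).symm

/-- Evaluation at the generator in degree zero, on morphisms of complexes out of `R[0]`. -/
def freeComplexEval (L : CochainComplex (FGModuleCat.{u} R) ℤ) :
    (freeComplex R ⟶ L) →ₗ[R] L.X 0 where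
  toFun f := evalOne _ ((freeComplexXZero R).hom ≫ f.f 0)
  map_add' f g := by
    rw [HomologicalComplex.add_f_apply, Preadditive.comp_add, map_add]
  map_smul' r f := by
    rw [HomologicalComplex.smul_f_apply, Linear.comp_smul, map_smul]
    rfl

lemma freeComplexEval_injective (L : CochainComplex (FGModuleCat.{u} R) ℤ) :
    Function.Injective (freeComplexEval L) := by
  intro f g h
  exact HomologicalComplex.from_single_hom_ext
    ((cancel_epi (freeComplexXZero R).hom).1 (evalOne_injective _ h))

variable [HasDerivedCategory.{w} (FGModuleCat.{u} R)]

/-- As `R[0]` is K-projective, its morphisms in the derived category come from morphisms of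
complexes. -/
lemma Q_map_surjective (L : CochainComplex (FGModuleCat.{u} R) ℤ) : Function.Surjective
    (DerivedCategory.Q.mapLinearMap R : (freeComplex R ⟶ L) →ₗ[R] _) := by
  intro f
  let e := DerivedCategory.quotientCompQhIso (FGModuleCat.{u} R)
  obtain ⟨g, hg⟩ := (CochainComplex.IsKProjective.Qh_map_bijective (freeComplex R)
    ((HomotopyCategory.quotient _ _).obj L)).2 (e.hom.app _ ≫ f ≫ e.inv.app _)
  obtain ⟨h, rfl⟩ := (HomotopyCategory.quotient _ _).map_surjective g
  refine ⟨h, ?_⟩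
  have h1 := e.hom.naturality h
  rw [Functor.comp_map, hg] at h1
  simp only [Category.assoc, Iso.inv_hom_id_app, Category.comp_id] at h1
  rw [cancel_epi] at h1
  exact h1.symm

lemma isNoetherian_hom_Q (L : CochainComplex (FGModuleCat.{u} R) ℤ) :
    IsNoetherian R (DerivedCategory.Q.obj (freeComplex R) ⟶ DerivedCategory.Q.obj L) := by
  have : Module.Finite R (L.X 0) := (L.X 0).property
  have h1 : IsNoetherian R (freeComplex R ⟶ L) :=
    isNoetherian_of_injective (freeComplexEval L) (freeComplexEval_injective L)
  exact isNoetherian_of_surjective _ (LinearMap.range_eq_top.2 (Q_map_surjective L))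

lemma subsingleton_hom_Q (L : CochainComplex (FGModuleCat.{u} R) ℤ) (h : IsZero (L.X 0)) :
    Subsingleton (DerivedCategory.Q.obj (freeComplex R) ⟶ DerivedCategory.Q.obj L) := by
  refine ⟨fun f g => ?_⟩
  obtain ⟨f, rfl⟩ := Q_map_surjective L f
  obtain ⟨g, rfl⟩ := Q_map_surjective L g
  congr 1
  exact HomologicalComplex.from_single_hom_ext (h.eq_of_tgt _ _)

instance (n : ℤ) : (shiftFunctor (Db R) n).Linear R :=
  shiftFunctor_linear_of_faithful R DerivedCategory.Bounded.ι n

/-- A finitely generated module, as a complex concentrated in degree zero. -/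
def Db.single (M : FGModuleCat.{u} R) : Db R :=
  ⟨(DerivedCategory.singleFunctor (FGModuleCat.{u} R) 0).obj M,
    ⟨⟨0, (inferInstance : ((DerivedCategory.singleFunctor (FGModuleCat.{u} R) 0).obj M).IsGE 0)⟩,
      ⟨0, (inferInstance : ((DerivedCategory.singleFunctor (FGModuleCat.{u} R) 0).obj M).IsLE 0)⟩⟩⟩

/-- Morphisms from `R[0]` to `Z[j]`, computed in the derived category with a complex
representing `Z`. -/
def homSingleEquiv (Z : Db R) (K : CochainComplex (FGModuleCat.{u} R) ℤ)
    (e : Z.obj ≅ DerivedCategory.Q.obj K) (j : ℤ) :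
    (Db.single (FGModuleCat.of R R) ⟶ Z⟦j⟧) ≃ₗ[R]
      (DerivedCategory.Q.obj (freeComplex R) ⟶ DerivedCategory.Q.obj (K⟦j⟧)) :=
  (LinearEquiv.ofBijective (DerivedCategory.Bounded.ι.mapLinearMap R)
    ⟨DerivedCategory.Bounded.ι.map_injective, DerivedCategory.Bounded.ι.map_surjective⟩).trans
    (Linear.homCongr R
      ((DerivedCategory.singleFunctorIsoCompQ (FGModuleCat.{u} R) 0).app (FGModuleCat.of R R))
      ((DerivedCategory.Bounded.ι.commShiftIso j).app Z ≪≫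
        (shiftFunctor _ j).mapIso e ≪≫ (DerivedCategory.Q.commShiftIso j).symm.app K))

lemma isNoetherian_hom_single (Z : Db R) (j : ℤ) :
    IsNoetherian R (Db.single (FGModuleCat.of R R) ⟶ Z⟦j⟧) := by
  have := isNoetherian_hom_Q ((DerivedCategory.Q.objPreimage Z.obj)⟦j⟧)
  exact isNoetherian_of_linearEquiv
    (homSingleEquiv Z _ (DerivedCategory.Q.objObjPreimageIso Z.obj).symm j).symm

lemma subsingleton_hom_single (Z : Db R) : ∃ n : ℕ, ∀ j : ℤ, (n : ℤ) < |j| →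
    Subsingleton (Db.single (FGModuleCat.of R R) ⟶ Z⟦j⟧) := by
  obtain ⟨⟨a, ha⟩, ⟨b, hb⟩⟩ := Z.property
  obtain ⟨K, _, _, ⟨e⟩⟩ := Z.obj.exists_iso_Q_obj_of_isGE_of_isLE a b
  refine ⟨max a.natAbs b.natAbs, fun j hj => ?_⟩
  have hK : IsZero ((K⟦j⟧).X 0) := by
    rcases lt_or_ge (0 + j) a with h | h
    · exact K.isZero_of_isStrictlyGE a _ h
    · have h' : b < 0 + j := by
        rw [Int.abs_eq_natAbs] at hj
        omega
      exact K.isZero_of_isStrictlyLE b _ h'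
  have := subsingleton_hom_Q _ hK
  exact (homSingleEquiv Z K e j).injective.subsingleton

lemma subsingleton_hom_single_single (M : FGModuleCat.{u} R) (j : ℤ) (hj : 0 < j) :
    Subsingleton (Db.single (FGModuleCat.of R R) ⟶ (Db.single M)⟦j⟧) := by
  have h := subsingleton_hom_Q
    (((CochainComplex.singleFunctor (FGModuleCat.{u} R) 0).obj M)⟦j⟧) (by
      exact HomologicalComplex.isZero_single_obj_X (ComplexShape.up ℤ) 0 M _ (by simp; lia))
  exact (homSingleEquiv (Db.single M) _
    ((DerivedCategory.singleFunctorIsoCompQ (FGModuleCat.{u} R) 0).app M) j).injective.subsingleton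

lemma exists_surjective_hom_single (M : FGModuleCat.{u} R) :
    ∃ φ : (Db.single (FGModuleCat.of R R) ⟶ (Db.single M)⟦(0 : ℤ)⟧) →ₗ[R] M,
      Function.Surjective φ := by
  let e1 : (FGModuleCat.of R R ⟶ M) ≃ₗ[R] ((Db.single (FGModuleCat.of R R)).obj ⟶
      (Db.single M).obj) :=
    LinearEquiv.ofBijective ((DerivedCategory.singleFunctor (FGModuleCat.{u} R) 0).mapLinearMap R)
      ⟨(DerivedCategory.singleFunctor (FGModuleCat.{u} R) 0).map_injective,
        (DerivedCategory.singleFunctor (FGModuleCat.{u} R) 0).map_surjective⟩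
  let e2 : (Db.single (FGModuleCat.of R R) ⟶ Db.single M) ≃ₗ[R]
      ((Db.single (FGModuleCat.of R R)).obj ⟶ (Db.single M).obj) :=
    LinearEquiv.ofBijective (DerivedCategory.Bounded.ι.mapLinearMap R)
      ⟨DerivedCategory.Bounded.ι.map_injective, DerivedCategory.Bounded.ι.map_surjective⟩
  let e3 := homPostcompEquiv R (Db.single (FGModuleCat.of R R))
    ((shiftFunctorZero (Db R) ℤ).app (Db.single M))
  refine ⟨evalOne M ∘ₗ (e3.trans (e2.trans e1.symm)).toLinearMap, ?_⟩
  exact (evalOne_surjective M).comp (e3.trans (e2.trans e1.symm)).surjective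

end Free

/-! ### Growth of iterated pushforwards of the free module -/

section Growth

variable {R : Type u} [CommRing R]

/-- The summand of index `j` as a lower bound of the weighted length. -/
lemma exp_mul_length_le_weightedLength {C : Type*} [Category* C] [Preadditive C] [HasShift C ℤ]
    [Linear R C] (t : ℝ) (A : C) {Z Z' : C} (i : Z ≅ Z') (j : ℤ) {N : Type*} [AddCommGroup N]
    [Module R N] (ψ : (A ⟶ Z'⟦j⟧) →ₗ[R] N) (hψ : Function.Surjective ψ) :
    ENNReal.ofReal (Real.exp (-j * t)) * (Module.length R N : ℝ≥0∞) ≤ weightedLength R t A Z := by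
  refine le_trans ?_ (ENNReal.le_tsum j)
  gcongr
  rw [(homPostcompEquiv R A ((shiftFunctor C j).mapIso i)).length_eq]
  exact Module.length_le_of_surjective ψ hψ

lemma isFG_restrictIter (φ : R →+* R) (hφ : φ.Finite) (N : ModuleCat.{u} R)
    (hN : ModuleCat.isFG R N) (e : ℕ) : ModuleCat.isFG R (restrictIter φ e N) := by
  induction e with
  | zero => exact hN
  | succ e ih => exact ((fgPushforward φ hφ).obj ⟨_, ih⟩).property

variable [IsNoetherianRing R] [HasDerivedCategory.{w} (FGModuleCat.{u} R)]

/-- The pushforward of a module, seen as a complex in degree zero, is computed on the module. -/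
def pushforwardSingleIso (φ : R →+* R) (hφ : φ.Finite) (M : FGModuleCat.{u} R) :
    (pushforward φ hφ).obj (Db.single M) ≅ Db.single ((fgPushforward φ hφ).obj M) :=
  DerivedCategory.Bounded.ι.preimageIso
    (((fgPushforward φ hφ).mapDerivedCategorySingleFunctor 0).app M)

lemma nonempty_iterate_pushforward_single_iso (φ : R →+* R) (hφ : φ.Finite)
    (M : FGModuleCat.{u} R) (e : ℕ) :
    Nonempty ((pushforward φ hφ).obj^[e] (Db.single M) ≅
      Db.single ⟨restrictIter φ e M.obj, isFG_restrictIter φ hφ M.obj M.property e⟩) := by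
  induction e with
  | zero => exact ⟨Iso.refl _⟩
  | succ e ih =>
    obtain ⟨i⟩ := ih
    rw [Function.iterate_succ_apply']
    exact ⟨(pushforward φ hφ).mapIso i ≪≫ pushforwardSingleIso φ hφ _⟩

/-- For a finite local endomorphism `φ` of a noetherian local ring of dimension at least `d` which
maps the maximal ideal into its `q`-th power, the complexity of the iterates of `φ_*` grows at
least like `([φ_* k : k] q ^ d) ^ e`. -/
theorem isBigOmega_complexity_pushforward [IsLocalRing R] (φ : R →+* R) [IsLocalHom φ]
    (hφ : φ.Finite) {q : ℕ} (hq : 0 < q)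
    (hm : (IsLocalRing.maximalIdeal R).map φ ≤ IsLocalRing.maximalIdeal R ^ q)
    {d : ℕ} (hd : (d : WithBot ℕ∞) ≤ ringKrullDim R) (t : ℝ) (G : Db R)
    (hG : IsSplitGenerator G) :
    IsBigOmega (fun e => complexity t G ((pushforward φ hφ).obj^[e] G))
      (fun e => ((residueDegree φ : ℝ) * (q : ℝ) ^ d) ^ e) := by
  obtain ⟨S, hS⟩ := (IsNoetherian.noetherian (IsLocalRing.maximalIdeal R) :
    (IsLocalRing.maximalIdeal R).FG)
  have hl : Ideal.span {x | x ∈ S.toList} = IsLocalRing.maximalIdeal R := by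
    simpa using hS
  obtain ⟨A, hA1, hA2, hA3, hA4⟩ := exists_koszulObject (R := R)
    (Db.single (FGModuleCat.of R R)) isNoetherian_hom_single subsingleton_hom_single S.toList
  have hfin : ∀ Z, weightedLength R t A Z ≠ ∞ := by
    intro Z
    refine weightedLength_ne_top t A Z (fun j => ?_) (hA2 Z)
    have := hA1 Z j
    refine Module.length_ne_top_iff.2 (isFiniteLength_of_span_eq_maximalIdeal S.toList hl ?_)
    intro x hx
    obtain ⟨n, hn⟩ := hA3 x hx
    exact ⟨n, smul_eq_zero_of_smul_id hn⟩
  obtain ⟨c, hc, hc'⟩ := exists_pow_le_length_quotient (R := R) hd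
  refine isBigOmega_of_weightedLength R t A hfin (pushforward φ hφ)
    (Db.single (FGModuleCat.of R R)) ?_ G hG
  set j : ℤ := (S.toList.length : ℤ)
  refine ⟨Real.exp (-j * t) * c, by positivity, Filter.Eventually.of_forall fun e => ?_⟩
  obtain ⟨i⟩ := nonempty_iterate_pushforward_single_iso φ hφ (FGModuleCat.of R R) e
  let I := IsLocalRing.maximalIdeal R ^ q ^ e
  obtain ⟨g, hg⟩ := exists_surjective_restrictIter φ e (N := ModuleCat.of R (R ⧸ I))
    (M := ModuleCat.of R R) (Submodule.mkQ I) (Submodule.mkQ_surjective I)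
  obtain ⟨f, hf⟩ := exists_surjective_hom_single (⟨restrictIter φ e (FGModuleCat.of R R).obj,
    isFG_restrictIter φ hφ _ (FGModuleCat.of R R).property e⟩ : FGModuleCat.{u} R)
  -- The quotient `φ^e_* (R / 𝔪 ^ (q ^ e))` of `φ^e_* R` is killed by the maximal ideal.
  have hkill : ∀ x ∈ S.toList, ∀ n : restrictIter φ e (ModuleCat.of R (R ⧸ I)), x • n = 0 := by
    intro x hx
    refine restrictIter_smul_eq_zero φ hm _ e 1 (fun r hr n => ?_) x ?_
    · rw [one_mul] at hr
      obtain ⟨n, rfl⟩ := Submodule.mkQ_surjective I n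
      exact (Submodule.Quotient.mk_eq_zero I).2 (I.mul_mem_right n hr)
    · rw [pow_one, ← hl]
      exact Ideal.subset_span hx
  obtain ⟨ψ, hψ⟩ := (hA4 _ fun j hj => subsingleton_hom_single_single _ j hj).2 _
    (g ∘ₗ f) (hg.comp hf) hkill
  -- Only the summand of degree `j` of the weighted length is needed.
  refine le_trans ?_ (exp_mul_length_le_weightedLength t A i j ψ hψ)
  have hfl : IsFiniteLength R (R ⧸ I) := by
    refine isFiniteLength_of_maximalIdeal_pow (n := q ^ e) fun x hx y => ?_
    obtain ⟨y, rfl⟩ := Submodule.mkQ_surjective I y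
    exact (Submodule.Quotient.mk_eq_zero I).2 (I.mul_mem_right y hx)
  rw [length_restrictIter φ hφ (R ⧸ I) hfl e]
  have h1 := hc' (q ^ e) (Nat.one_le_pow _ _ hq)
  calc ENNReal.ofReal (Real.exp (-j * t) * c * ((residueDegree φ : ℝ) * (q : ℝ) ^ d) ^ e)
      = ENNReal.ofReal (Real.exp (-j * t)) * ((residueDegree φ : ℝ≥0∞) ^ e *
          ENNReal.ofReal (c * ((q ^ e : ℕ) : ℝ) ^ d)) := by
        rw [← ENNReal.ofReal_natCast, ← ENNReal.ofReal_pow (by positivity),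
          ← ENNReal.ofReal_mul (by positivity), ← ENNReal.ofReal_mul (by positivity)]
        congr 1
        push_cast
        ring
    _ ≤ _ := by
        push_cast at h1 ⊢
        gcongr

end Growth

/-! ### Power series on a monoid -/

section MonoidLocal

variable (k : Type u) [Field k] (Γ : Type v) [AddCommMonoid Γ]

/-- The augmentation `k[Γ] → k` which kills `t^a` for `a ≠ 0`. It is multiplicative because `Γ` has
no nonzero invertible elements. -/
def augmentation [Subsingleton (AddUnits Γ)] : AddMonoidAlgebra k Γ →ₐ[k] k :=
  open Classical in
  AddMonoidAlgebra.lift k k Γ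
    { toFun := fun a => if a.toAdd = 0 then 1 else 0
      map_one' := by simp
      map_mul' := fun a b => by
        by_cases ha : a.toAdd = 0 <;> by_cases hb : b.toAdd = 0 <;>
          simp [add_eq_zero, ha, hb] }

lemma augmentation_single [Subsingleton (AddUnits Γ)] {a : Γ} (ha : a ≠ 0) :
    augmentation k Γ (AddMonoidAlgebra.single a 1) = 0 := by
  simp [augmentation, ha]

instance isMaximal_monomialIdeal [Subsingleton (AddUnits Γ)] : (monomialIdeal k Γ).IsMaximal := by
  have hle : monomialIdeal k Γ ≤ RingHom.ker (augmentation k Γ) := by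
    refine Ideal.span_le.2 ?_
    rintro _ ⟨a, ha, rfl⟩
    exact augmentation_single k Γ ha
  have hex : ∀ x : AddMonoidAlgebra k Γ, ∃ c : k,
      x - algebraMap k _ c ∈ monomialIdeal k Γ := by
    intro x
    induction x using AddMonoidAlgebra.induction_linear with
    | zero => exact ⟨0, by simp⟩
    | add x y hx hy =>
      obtain ⟨a, ha⟩ := hx
      obtain ⟨b, hb⟩ := hy
      exact ⟨a + b, by simpa only [map_add, add_sub_add_comm] using Ideal.add_mem _ ha hb⟩
    | single a c =>
      by_cases ha : a = 0
      · exact ⟨c, by simp [ha]⟩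
      · exact ⟨0, by simpa using single_mem_monomialIdeal k ha c⟩
  have heq : monomialIdeal k Γ = RingHom.ker (augmentation k Γ) := by
    refine le_antisymm hle fun x hx => ?_
    obtain ⟨c, hc⟩ := hex x
    have h1 := hle hc
    rw [RingHom.mem_ker] at hx h1
    rw [map_sub, hx, AlgHom.commutes, zero_sub, neg_eq_zero] at h1
    have : c = 0 := h1
    simpa [this] using hc
  rw [heq]
  exact RingHom.ker_isMaximal_of_surjective _ fun c => ⟨algebraMap k _ c, (augmentation k Γ).commutes c⟩

variable [AddMonoid.FG Γ] [Subsingleton (AddUnits Γ)]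

instance isMaximal_map_monomialIdeal : ((monomialIdeal k Γ).map
    (algebraMap (AddMonoidAlgebra k Γ) (MonoidPowerSeries k Γ))).IsMaximal :=
  AdicCompletion.isMaximal_map_of_le _ _ le_rfl (IsNoetherian.noetherian _)

instance isLocalRing_monoidPowerSeries : IsLocalRing (MonoidPowerSeries k Γ) := by
  have := AdicCompletion.isAdicComplete_self (monomialIdeal k Γ) (IsNoetherian.noetherian _)
  exact isLocalRing_of_isAdicComplete_maximal ((monomialIdeal k Γ).map
    (algebraMap (AddMonoidAlgebra k Γ) (MonoidPowerSeries k Γ)))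

lemma maximalIdeal_monoidPowerSeries : IsLocalRing.maximalIdeal (MonoidPowerSeries k Γ) =
    (monomialIdeal k Γ).map (algebraMap (AddMonoidAlgebra k Γ) (MonoidPowerSeries k Γ)) :=
  (IsLocalRing.eq_maximalIdeal (isMaximal_map_monomialIdeal k Γ)).symm

lemma map_mulEndo_maximalIdeal_le (m : ℕ) (hm : 0 < m) :
    (IsLocalRing.maximalIdeal (MonoidPowerSeries k Γ)).map (mulEndo k Γ m hm) ≤
      IsLocalRing.maximalIdeal (MonoidPowerSeries k Γ) ^ m := by
  rw [maximalIdeal_monoidPowerSeries, Ideal.map_map, ← Ideal.map_pow, Ideal.map_le_iff_le_comap]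
  refine Ideal.span_le.2 ?_
  rintro _ ⟨a, ha, rfl⟩
  rw [SetLike.mem_coe, Ideal.mem_comap, RingHom.comp_apply, mulEndo, completionMap_of, monoidMulHom_single, ← one_pow (M := k) m,
    ← AddMonoidAlgebra.single_pow]
  exact Ideal.mem_map_of_mem _ (Ideal.pow_mem_pow (single_mem_monomialIdeal k ha 1) m)

instance isLocalHom_mulEndo (m : ℕ) (hm : 0 < m) : IsLocalHom (mulEndo k Γ m hm) := by
  refine ((IsLocalRing.local_hom_TFAE (mulEndo k Γ m hm)).out 0 2).2 ?_
  exact (map_mulEndo_maximalIdeal_le k Γ m hm).trans (Ideal.pow_le_self hm.ne')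

end MonoidLocal

end CategoricalEntropy

end

theorem corollary3p3 :
    (∀ (R : Type u) [CommRing R] [IsLocalRing R] [IsNoetherianRing R]
      (p : ℕ) [Fact p.Prime] [CharP R p] (hF : (frobenius R p).Finite)
      (d : ℕ) (_ : ringKrullDim R = d)
      [HasDerivedCategory.{w} (FGModuleCat.{u} R)]
      (t : ℝ) (G : Db R), IsSplitGenerator G →
        IsBigOmega
          (fun e => complexity t G ((pushforward (frobenius R p) hF).obj^[e] G))
          (fun e => ((residueDegree (frobenius R p) : ℝ) * (p : ℝ) ^ d) ^ e) ∧
        Filter.Tendsto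
          (fun e : ℕ => ENNReal.log
            (complexity t G ((pushforward (frobenius R p) hF).obj^[e] G)) / (e : EReal))
          Filter.atTop (𝓝 (categoricalEntropy t (pushforward (frobenius R p) hF))) ∧
        ((d * Real.log p + Real.log (residueDegree (frobenius R p)) : ℝ) : EReal) ≤
          categoricalEntropy t (pushforward (frobenius R p) hF)) ∧
    (∀ (k : Type u') [Field k] (Γ : Type v) [AddCommMonoid Γ] [AddMonoid.FG Γ]
      [Subsingleton (AddUnits Γ)] (m : ℕ) (hm : 0 < m)
      (d : ℕ) (_ : ringKrullDim (MonoidPowerSeries k Γ) = d)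
      [HasDerivedCategory.{w'} (FGModuleCat.{max u' v} (MonoidPowerSeries k Γ))]
      (t : ℝ) (G : Db (MonoidPowerSeries k Γ)), IsSplitGenerator G →
        IsBigOmega
          (fun e => complexity t G
            ((pushforward (mulEndo k Γ m hm) (mulEndo_finite k Γ m hm)).obj^[e] G))
          (fun e => (m : ℝ) ^ (d * e)) ∧
        Filter.Tendsto
          (fun e : ℕ => ENNReal.log (complexity t G
            ((pushforward (mulEndo k Γ m hm) (mulEndo_finite k Γ m hm)).obj^[e] G)) / (e : EReal))
          Filter.atTop (𝓝 (categoricalEntropy t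
            (pushforward (mulEndo k Γ m hm) (mulEndo_finite k Γ m hm)))) ∧
        ((d * Real.log m : ℝ) : EReal) ≤
          categoricalEntropy t
            (pushforward (mulEndo k Γ m hm) (mulEndo_finite k Γ m hm))) := by
  refine ⟨fun R _ _ _ p _ _ hF d hd _ t G hG => ?_,
    fun k _ Γ _ _ _ m hm d hd _ t G hG => ?_⟩
  · have hp : 0 < p := (Fact.out : p.Prime).pos
    have hD := residueDegree_pos (frobenius R p) hF
    have hm : (IsLocalRing.maximalIdeal R).map (frobenius R p) ≤
        IsLocalRing.maximalIdeal R ^ p :=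
      Ideal.map_le_iff_le_comap.2 fun x hx => Ideal.pow_mem_pow hx p
    have h := isBigOmega_complexity_pushforward (frobenius R p) hF hp hm hd.ge t
    have hb : (0 : ℝ) < (residueDegree (frobenius R p) : ℝ) * (p : ℝ) ^ d := by positivity
    obtain ⟨h1, h2⟩ := tendsto_categoricalEntropy hb h hG
    refine ⟨h G hG, h1, ?_⟩
    rwa [Real.log_mul (by positivity) (by positivity), Real.log_pow, add_comm] at h2
  · have hD := residueDegree_pos (mulEndo k Γ m hm) (mulEndo_finite k Γ m hm)
    have h : ∀ G : Db (MonoidPowerSeries k Γ), IsSplitGenerator G → IsBigOmega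
        (fun e => complexity t G
          ((pushforward (mulEndo k Γ m hm) (mulEndo_finite k Γ m hm)).obj^[e] G))
        (fun e => ((m : ℝ) ^ d) ^ e) := by
      intro G hG
      obtain ⟨c, hc, hc'⟩ := isBigOmega_complexity_pushforward (mulEndo k Γ m hm)
        (mulEndo_finite k Γ m hm) hm (map_mulEndo_maximalIdeal_le k Γ m hm) hd.ge t G hG
      -- The residue degree is at least `1`, and can be dropped from the lower bound.
      have hD' : (1 : ℝ) ≤ residueDegree (mulEndo k Γ m hm) := by exact_mod_cast hD
      refine ⟨c, hc, hc'.mono fun e he => le_trans (ENNReal.ofReal_le_ofReal ?_) he⟩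
      exact mul_le_mul_of_nonneg_left (pow_le_pow_left₀ (by positivity)
        (le_mul_of_one_le_left (by positivity) hD') e) hc.le
    have hb : (0 : ℝ) < (m : ℝ) ^ d := by positivity
    obtain ⟨h1, h2⟩ := tendsto_categoricalEntropy hb h hG
    refine ⟨?_, h1, by rwa [Real.log_pow] at h2⟩
    simpa only [pow_mul] using h G hG
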